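/- Let $T$ be a complete first-order theory in a language $L$, let $\mathfrak C$ be a monster model of $T$ (that is, for some uncountable strong limit cardinal $\mu$, $\mathfrak C$ is $\mu$-saturated and strongly $\mu$-homogeneous), and call a set small if its cardinality is less than $\mu$. Let $\perp$ be a symmetric independence relation on the small subsets of $\mathfrak C$, where $A\perp_B C$ is read "$A$ is independent from $C$ over $B$". That is, for all small $A,B,C,D\subseteq\mathfrak C$: * (Invariance) $A\perp_B C$ implies $\sigma(A)\perp_{\sigma(B)}\sigma(C)$ for $\sigma\in\mathrm{Aut}(\mathfrak C)$; * (Normality) $A\perp_C B$ implies $A\cup C\perp_C B$; * (Symmetry) $A\perp_B C$ implies $C\perp_B A$; * (Transitivity) if $B\subseteq C\subseteq D$, then $A\perp_B D$ iff $A\perp_B C$ and $A\perp_C D$; * (Finite character) $A\perp_B C$ iff $A_0\perp_B C$ for all finite $A_0\subseteq A$; * (Extension) there is $A'\equiv_B A$ with $A'\perp_B C$; * (Local character) there is a small cardinal $\lambda_0$, depending only on $\perp$, such that for all small $A$, $C$ there is $C_0\subseteq C$ with $|C_0|<\lambda_0+|A|^+$ and $A\perp_{C_0}C$. Let $\kappa_0$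 be the smallest regular cardinal such that for every finite tuple $\bar a$ and every small $B$ there is $B_0\subseteq B$ with $|B_0|<\kappa_0$ and $\bar a\perp_{B_0}B$. Fix a small cardinal $\kappa>\max(\kappa_0,|T|)$, where $|T|=\max(\aleph_0,|L|)$, and call a set very small if its cardinality is less than $\kappa$. For a complete type $q$ over a small set $A$ and a small set $B$, write $q\perp_B A$ if some realization $\bar c$ of $q$ in $\mathfrak C$ satisfies $\bar c\perp_B A$. Let $P$ be a new unary predicate and $L^2=L\cup\{P\}$. An $L^2$-structure $(M,P(M))$ with $M\preceq\mathfrak C$ is a lovely pair if: 1. $M$ is small; 2. (Density) for every very small $A\subseteq M$, every complete $L$-$1$-type $q$ over $A$ with $q\perp_{P(M)\cap A}A$ is realized in $P(M)$; 3. (Extension) for every very small $A\subseteq M$, every complete $L$-$1$-type $q$ over $A$ is realized by some $b\in M$ with $b\perp_A P(M)$. Let $T^d$ be the $L^2$-theory of all lovely pairs. Assume that loveliness is first order: every sufficiently saturated model of $T^d$ is a lovely pair, i.e. there is a small cardinal $\lambda$ such that every $\lambda$-saturated small model $(M,P(M))$ of $T^d$ with $M\preceq\mathfrak C$ is a lovely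 pair. Then every parameter-free $L^2$-formula $\theta(\bar x)$ is equivalent modulo $T^d$ to a Boolean combination of special formulas, i.e. of parameter-free formulas of the form $\exists\bar z\,\bigl(P(z_1)\wedge\dots\wedge P(z_m)\wedge\varphi(\bar x,\bar z)\bigr)$ with $\varphi$ an $L$-formula. -/

import Mathlib

universe u w

open FirstOrder FirstOrder.Language Cardinal

namespace LovelyPairs

noncomputable section

/-! ### Types over parameter sets, saturation, monster models -/

section Types

variable (L : FirstOrder.Language.{u, u}) {M : Type u} [L.Structure M] [Nonempty M]

/-- `S_ι(A)`: complete `L`-types over the parameter set `A ⊆ M` in variables indexed by `ι`. -/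
abbrev TypesOver (A : Set M) (ι : Type w) : Type (max u w) :=
  (L[[A]].completeTheory M).CompleteType ι

/-- `tp(v / A)`: the complete `L`-type over `A` of a (possibly infinite) tuple `v` from `M`. -/
def tp (A : Set M) {ι : Type w} (v : ι → M) : TypesOver L A ι :=
  (L[[A]].completeTheory M).typeOf v

variable (M) in
/-- `M` is `μ`-saturated: every complete `1`-type over fewer than `μ` parameters is realized. -/
def IsSaturated (μ : Cardinal.{u}) : Prop :=
  ∀ A : Set M, #A < μ → ∀ q : TypesOver L A (Fin 1), ∃ c : Fin 1 → M, tp L A c = q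

end Types

/-- `Ω` is strongly `μ`-homogeneous: every partial elementary map with a domain of fewer than `μ`
elements extends to an automorphism. -/
def IsStronglyHomogeneous (L : FirstOrder.Language.{u, u}) (Ω : Type u) [L.Structure Ω]
    (μ : Cardinal.{u}) : Prop :=
  ∀ (A : Set Ω) (f : A → Ω), #A < μ →
    (∀ φ : L.Formula A, φ.Realize f ↔ φ.Realize (Subtype.val : A → Ω)) →
      ∃ σ : Ω ≃[L] Ω, ∀ a : A, σ a = f a

/-- `Ω` is a monster model, of monstrosity `μ`, of the complete theory `T`. A set is then *small*
if it has fewer than `μ` elements. -/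
structure IsMonster {L : FirstOrder.Language.{u, u}} (T : L.Theory) (Ω : Type u) [L.Structure Ω] [Nonempty Ω]
    (μ : Cardinal.{u}) : Prop where
  complete : T.IsComplete
  model : Ω ⊨ T
  uncountable : ℵ₀ < μ
  strongLimit : μ.IsStrongLimit
  saturated : IsSaturated L Ω μ
  homogeneous : IsStronglyHomogeneous L Ω μ

/-! ### Independence relations -/

section Independence

variable (L : FirstOrder.Language.{u, u}) {Ω : Type u} [L.Structure Ω] [Nonempty Ω] (μ : Cardinal.{u})

/-- `Ind A B C` is read "`A` is independent from `C` over `B`". Only its values on small sets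
matter. -/
structure IsIndependenceRelation (Ind : Set Ω → Set Ω → Set Ω → Prop) : Prop where
  invariance : ∀ A B C : Set Ω, #A < μ → #B < μ → #C < μ → ∀ σ : Ω ≃[L] Ω,
    Ind A B C → Ind (σ '' A) (σ '' B) (σ '' C)
  normality : ∀ A B C : Set Ω, #A < μ → #B < μ → #C < μ → Ind A C B → Ind (A ∪ C) C B
  symmetry : ∀ A B C : Set Ω, #A < μ → #B < μ → #C < μ → Ind A B C → Ind C B A
  transitivity : ∀ A B C D : Set Ω, #A < μ → #B < μ → #C < μ → #D < μ → B ⊆ C → C ⊆ D →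
    (Ind A B D ↔ Ind A B C ∧ Ind A C D)
  finiteCharacter : ∀ A B C : Set Ω, #A < μ → #B < μ → #C < μ →
    (Ind A B C ↔ ∀ A₀ : Set Ω, A₀ ⊆ A → A₀.Finite → Ind A₀ B C)
  /-- There is `A' ≡_B A` with `A'` independent from `C` over `B`; the set `A'` is given by
  an enumeration `f : A → Ω` that has the same type over `B` as the identity enumeration of `A`. -/
  extension : ∀ A B C : Set Ω, #A < μ → #B < μ → #C < μ →
    ∃ f : A → Ω, tp L B f = tp L B (Subtype.val : A → Ω) ∧ Ind (Set.range f) B C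
  localCharacter : ∃ κ₀ : Cardinal.{u}, κ₀ < μ ∧ ∀ A C : Set Ω, #A < μ → #C < μ →
    ∃ C₀ : Set Ω, C₀ ⊆ C ∧ #C₀ < κ₀ + Order.succ #A ∧ Ind A C₀ C

/-- The cardinal `κ₀` of an independence relation: the smallest regular cardinal `κ` such that for
every finite tuple `a` and every small set `B` there is `B₀ ⊆ B` with `|B₀| < κ` and `a`
independent from `B` over `B₀`. -/
def kappaZero (Ind : Set Ω → Set Ω → Set Ω → Prop) : Cardinal.{u} :=
  sInf {κ | κ.IsRegular ∧ ∀ A B : Set Ω, A.Finite → #B < μ →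
    ∃ B₀ : Set Ω, B₀ ⊆ B ∧ #B₀ < κ ∧ Ind A B₀ B}

variable {A : Set Ω} in
/-- The complete type `q` over `A` is independent from `A` over `B` (does not fork over `B`). -/
def NonForking (Ind : Set Ω → Set Ω → Set Ω → Prop) {n : ℕ} (q : TypesOver L A (Fin n))
    (B : Set Ω) : Prop :=
  ∃ c : Fin n → Ω, tp L A c = q ∧ Ind (Set.range c) B A

end Independence

/-! ### The language with a predicate `P` -/

/-- The relation symbols of the language consisting of one unary predicate. -/
inductive PredRel : ℕ → Type
  | P : PredRel 1

/-- The language `{P}` with one unary predicate. -/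
def predLanguage : FirstOrder.Language.{0, 0} := ⟨fun _ => Empty, PredRel⟩

/-- `L² = L ∪ {P}`. -/
abbrev L2 (L : FirstOrder.Language.{u, u}) : FirstOrder.Language.{u, u} := L.sum predLanguage

/-- The predicate symbol `P` of `L²`. -/
def predSymbol (L : FirstOrder.Language.{u, u}) : (L2 L).Relations 1 := Sum.inr PredRel.P

/-- The underlying set of the `L²`-structure `(M, P)`. -/
def PairOf {M : Type u} (_P : Set M) : Type u := M

section Pair

variable (L : FirstOrder.Language.{u, u}) {M : Type u} (P : Set M)

instance [L.Structure M] : L.Structure (PairOf P) := inferInstanceAs (L.Structure M)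

instance : predLanguage.Structure (PairOf P) where
  funMap f := f.elim
  RelMap {n} (R : PredRel n) := match n, R with
    | _, PredRel.P => fun v => (v 0 : M) ∈ P

instance [Nonempty M] : Nonempty (PairOf P) := inferInstanceAs (Nonempty M)

end Pair

/-! ### Lovely pairs and their theory -/

section Lovely

variable (L : FirstOrder.Language.{u, u}) {Ω : Type u} [L.Structure Ω] [Nonempty Ω] (μ κ : Cardinal.{u})
  (Ind : Set Ω → Set Ω → Set Ω → Prop)

/-- `(M, P)` is a `κ`-lovely pair, for `M` an elementary substructure of the monster `Ω` and
`P ⊆ M`. A set is *very small* if it has fewer than `κ` elements. -/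
structure IsLovelyPair (M : L.ElementarySubstructure Ω) (P : Set M) : Prop where
  small : #M < μ
  density : ∀ A : Set Ω, A ⊆ (M : Set Ω) → #A < κ → ∀ q : TypesOver L A (Fin 1),
    NonForking L Ind q (A ∩ Subtype.val '' P) →
      ∃ b : Fin 1 → Ω, b 0 ∈ Subtype.val '' P ∧ tp L A b = q
  extension : ∀ A : Set Ω, A ⊆ (M : Set Ω) → #A < κ → ∀ q : TypesOver L A (Fin 1),
    ∃ b : Fin 1 → Ω, b 0 ∈ (M : Set Ω) ∧ tp L A b = q ∧
      Ind (Set.range b) A (Subtype.val '' P)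

/-- `T^d`: the `L²`-theory of all `κ`-lovely pairs. -/
def lovelyTheory : (L2 L).Theory :=
  {σ | ∀ (M : L.ElementarySubstructure Ω) (P : Set M),
    IsLovelyPair L μ κ Ind M P → PairOf P ⊨ σ}

/-- Loveliness is first order: every sufficiently saturated (small) model of `T^d` is a
lovely pair. -/
def LovelinessIsFirstOrder : Prop :=
  ∃ l : Cardinal.{u}, l < μ ∧ ∀ (M : L.ElementarySubstructure Ω) (P : Set M), #M < μ →
    PairOf P ⊨ lovelyTheory L μ κ Ind → IsSaturated (L2 L) (PairOf P) l →
      IsLovelyPair L μ κ Ind M P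

end Lovely

/-! ### Special formulas -/

section Special

variable {L : FirstOrder.Language.{u, u}}

/-- The formula `∃ z₁ … z_m (P(z₁) ∧ … ∧ P(z_m) ∧ φ(x, z))`. -/
def specialFormula {n m : ℕ} (φ : L.BoundedFormula (Fin n) m) : (L2 L).Formula (Fin n) :=
  (BoundedFormula.iInf (fun i : Fin m =>
      (predSymbol L).boundedFormula₁ (Term.var (Sum.inr i))) ⊓
    (LHom.sumInl : L →ᴸ L2 L).onBoundedFormula φ).exs

/-- `χ` is a special formula. -/
def IsSpecial {n : ℕ} (χ : (L2 L).Formula (Fin n)) : Prop :=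
  ∃ (m : ℕ) (φ : L.BoundedFormula (Fin n) m), χ = specialFormula φ

end Special

/-- The Boolean combinations of formulas from a given class. -/
inductive IsBooleanCombination {L : FirstOrder.Language.{u, u}} {α : Type w} (S : L.Formula α → Prop) :
    L.Formula α → Prop
  | of {φ : L.Formula α} : S φ → IsBooleanCombination S φ
  | not {φ : L.Formula α} : IsBooleanCombination S φ → IsBooleanCombination S φ.not
  | inf {φ ψ : L.Formula α} : IsBooleanCombination S φ → IsBooleanCombination S ψ →
      IsBooleanCombination S (φ ⊓ ψ)
  | sup {φ ψ : L.Formula α} : IsBooleanCombination S φ → IsBooleanCombination S ψ →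
      IsBooleanCombination S (φ ⊔ ψ)

end

end LovelyPairs

open LovelyPairs

/-!
A lovely pair `(M, P)` is rich enough for a back-and-forth argument, as long as the sets matched so
far are *free*: `A ⊆ M` is free in `(M, P)` if `A` is independent from `P` over `A ∩ P`. A free map
(`IsFreeMap`) is an automorphism of the monster that carries a very small free set of one lovely
pair to a free set of another and respects the predicates. Such a map extends to any further element
`c` (`IsFreeMap.exists_forth`, `IsFreeMap.exists_back`): density enlarges the domain by elements of
`P` until it contains a base for the independence of `c` from `P`, and then the extension property
gives an image of `c`. Hence free maps preserve all formulas of the language of pairs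
(`IsFreeMap.realize_iff`).

Next, if `a` and `b` satisfy the same special formulas in two sufficiently saturated lovely pairs
`(M, P)` and `(N, Q)`, then some free map takes `a` to `b` (`exists_isFreeMap`). After moving
`(N, Q)` by an automorphism of the monster, `a = b`. Call a set `B` reflected if every formula over `a`
that holds for a finite tuple from `B` also holds for some tuple from `P`; equivalently, since the
special formulas true of `a` agree, for some tuple from `Q`. By saturation, a very small reflected
set has a copy over `a` inside `P`, and another one inside `Q`. Among reflected sets there is a `B`
of size at most `κ₀` such that `a` is independent over `B` from every finite reflected enlargement
of `B`, as otherwise a dependent chain of length `κ₀` would contradict local character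
(`IsIndependenceRelation.exists_no_dependent_extension`). Then `a` is independent from `P` over the
copy of `B` in `P`, because finite subsets of `P` pull back to enlargements of `B`, and likewise for
`Q`. So `a` together with the copy of `B` is free on either side.

By compactness of the type spaces of `lovelyTheory` (`exists_isBooleanCombination_iff`), it remains
to see that two complete types with the same special formulas coincide, which follows once every
type is realized in a sufficiently saturated lovely pair (`exists_isLovelyPair_realizing`). Since
loveliness is first order, this needs only a saturated structure of fewer than `μ` elements, which
then embeds elementarily in the monster. It comes from `exists_realizesTypes`: every structure has,
for each `θ` bounding the size of the language, an elementarily equivalent structure of size at most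
`2 ^ θ` that realizes types in `θ` variables over `θ` parameters. A well-founded set `W` of names
for the required realizations is fixed in advance; it is closed under forming a name for a
realization of any set of formulas about tuples already named. An ultrafilter on `W → (K → M)`, with
`K` of size `θ`, is built along a well-order of `W` so that in the ultrapower the tuple named by
`w`, which is the class of `i ↦ i w`, realizes whatever it should (`exists_generic_ultrafilter`).
The named elements then form an elementary substructure.
-/

namespace LovelyPairs

/-! ### Ultrafilters generic along a well-order -/

section GenericUltrafilter

open Filter Set

variable {W X : Type*} [LinearOrder W]

/-- The part of a filter on `W → X` that is visible on the coordinates below `w`: it is generated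
by the members of the filter that depend on these coordinates only. -/
def cutFilter (w : W) (F : Filter (W → X)) : Filter (W → X) :=
  comap (Set.domRestrict (Iio w)) (map (Set.domRestrict (Iio w)) F)

theorem le_cutFilter (w : W) (F : Filter (W → X)) : F ≤ cutFilter w F :=
  le_comap_map

theorem cutFilter_mono (w : W) {F G : Filter (W → X)} (h : F ≤ G) :
    cutFilter w F ≤ cutFilter w G :=
  comap_mono (map_mono h)

theorem mem_cutFilter_of_determined {w : W} {F : Filter (W → X)} {S : Set (W → X)}
    (hS : ∀ i j : W → X, (∀ v < w, i v = j v) → i ∈ S → j ∈ S) (h : S ∈ F) :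
    S ∈ cutFilter w F := by
  refine ⟨Set.domRestrict (Iio w) '' S, image_mem_map h, ?_⟩
  rintro j ⟨i, hi, hij⟩
  exact hS i j (fun v hv => congrFun hij ⟨v, hv⟩) hi

theorem exists_determined_of_mem_cutFilter {w : W} {F : Filter (W → X)} {S : Set (W → X)}
    (h : S ∈ cutFilter w F) :
    ∃ R ∈ F, R ⊆ S ∧ ∀ i j : W → X, (∀ v < w, i v = j v) → i ∈ R → j ∈ R := by
  obtain ⟨R, hR, hRS⟩ := h
  refine ⟨_, hR, hRS, fun i j hij hi => ?_⟩
  have : Set.domRestrict (Iio w) i = Set.domRestrict (Iio w) j := funext fun v => hij v v.2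
  rw [Set.mem_preimage] at *
  rwa [← this]

theorem cutFilter_cutFilter_le {v w : W} (h : v ≤ w) (F : Filter (W → X)) :
    cutFilter w (cutFilter v F) ≤ cutFilter v F := by
  intro S hS
  obtain ⟨R, hR, hRS, hd⟩ := exists_determined_of_mem_cutFilter hS
  exact mem_of_superset (mem_cutFilter_of_determined
    (fun i j hij => hd i j fun u hu => hij u (hu.trans_le h))
    (mem_cutFilter_of_determined hd hR)) hRS

open Classical in
/-- One step of the construction of a generic ultrafilter: decide all sets that depend on the
coordinates below `w`, then add the family `𝒞` if it is compatible with that decision. -/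
noncomputable def genericStep (w : W) (𝒞 : Set (Set (W → X))) (H : Filter (W → X)) :
    Filter (W → X) :=
  if _h : H.NeBot then
    let F := cutFilter w (Ultrafilter.of H : Filter (W → X))
    if ∀ s : Set (Set (W → X)), s.Finite → s ⊆ 𝒞 →
        {i | ∃ y, Function.update i w y ∈ ⋂₀ s} ∈ F then F ⊓ generate 𝒞 else F
  else ⊥

/-- The filters obtained by iterating `genericStep` along the well-order `W`. -/
noncomputable def genericFilter [WellFoundedLT W] (𝒞 : W → Set (Set (W → X))) :
    W → Filter (W → X) :=
  wellFounded_lt.fix fun w ih => genericStep w (𝒞 w) (⨅ v : Iio w, ih v v.2)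

theorem genericFilter_eq [WellFoundedLT W] (𝒞 : W → Set (Set (W → X))) (w : W) :
    genericFilter 𝒞 w = genericStep w (𝒞 w) (⨅ v : Iio w, genericFilter 𝒞 v) :=
  wellFounded_lt.fix_eq _ _

/-- A family `𝒞` can be added to a filter generated by sets that depend on the coordinates below `w`
if this filter contains the projections of the finite intersections of members of `𝒞`: changing the
coordinate `w` alone does not leave a set that depends on earlier coordinates. -/
theorem neBot_inf_generate {w : W} {𝒞 : Set (Set (W → X))} {F : Filter (W → X)} [F.NeBot]
    (h : ∀ s : Set (Set (W → X)), s.Finite → s ⊆ 𝒞 →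
      {i | ∃ y, Function.update i w y ∈ ⋂₀ s} ∈ cutFilter w F) :
    (cutFilter w F ⊓ generate 𝒞).NeBot := by
  rw [Filter.inf_neBot_iff]
  intro S hS R hR
  obtain ⟨s, hs𝒞, hsf, hsR⟩ := mem_generate_iff.1 hR
  obtain ⟨S', hS', hS'S, hd⟩ := exists_determined_of_mem_cutFilter hS
  obtain ⟨R', hR', hR's, -⟩ := exists_determined_of_mem_cutFilter (h s hsf hs𝒞)
  obtain ⟨i, hi, hi'⟩ := (inferInstance : F.NeBot).nonempty_of_mem (inter_mem hS' hR')
  obtain ⟨y, hy⟩ := hR's hi'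
  refine ⟨_, hS'S (hd i _ (fun v hv => ?_) hi), hsR hy⟩
  rw [Function.update_of_ne hv.ne]

/-- The properties of `genericStep` that are needed to iterate it: the filter is proper and
refines `H`, and for every `v > w` it is generated by sets that depend on the coordinates below `v`.
Any ultrafilter that refines it contains `𝒞` as soon as it contains the projections, along `w`, of
the finite intersections of members of `𝒞`. -/
theorem genericStep_spec {w : W} {𝒞 : Set (Set (W → X))} {H : Filter (W → X)} (hH : H.NeBot)
    (hcut : cutFilter w H ≤ H)
    (h𝒞 : ∀ S ∈ 𝒞, ∀ i j : W → X, (∀ v ≤ w, i v = j v) → i ∈ S → j ∈ S) :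
    (genericStep w 𝒞 H).NeBot ∧ genericStep w 𝒞 H ≤ H ∧
      (∀ v, w < v → cutFilter v (genericStep w 𝒞 H) ≤ genericStep w 𝒞 H) ∧
      ∀ U : Ultrafilter (W → X), (U : Filter (W → X)) ≤ genericStep w 𝒞 H →
        (∀ s : Set (Set (W → X)), s.Finite → s ⊆ 𝒞 →
          {i | ∃ y, Function.update i w y ∈ ⋂₀ s} ∈ U) → ∀ S ∈ 𝒞, S ∈ U := by
  set F := cutFilter w (Ultrafilter.of H : Filter (W → X)) with hF
  have hFH : F ≤ H := (cutFilter_mono w (Ultrafilter.of_le H)).trans hcut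
  have hFne : F.NeBot := NeBot.mono inferInstance (le_cutFilter w _)
  have hFcut : ∀ v, w < v → cutFilter v F ≤ F := fun v hv => cutFilter_cutFilter_le hv.le _
  -- An ultrafilter below `F` agrees with `F` on sets that depend on the coordinates below `w`.
  have hdec : ∀ U : Ultrafilter (W → X), (U : Filter (W → X)) ≤ F → ∀ S ∈ U,
      (∀ i j : W → X, (∀ v < w, i v = j v) → i ∈ S → j ∈ S) → S ∈ F := by
    intro U hU S hS hd
    rcases Ultrafilter.mem_or_compl_mem (Ultrafilter.of H) S with h | h
    · exact mem_cutFilter_of_determined hd h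
    · have : Sᶜ ∈ F := mem_cutFilter_of_determined
        (fun i j hij hi hj => hi (hd j i (fun v hv => (hij v hv).symm) hj)) h
      exact absurd hS (Ultrafilter.compl_mem_iff_notMem.1 (hU this))
  by_cases hc : ∀ s : Set (Set (W → X)), s.Finite → s ⊆ 𝒞 →
        {i | ∃ y, Function.update i w y ∈ ⋂₀ s} ∈ F
  · have hG : genericStep w 𝒞 H = F ⊓ generate 𝒞 := by
      simp only [genericStep, dif_pos hH]
      exact if_pos hc
    rw [hG]
    refine ⟨neBot_inf_generate hc, inf_le_left.trans hFH, fun v hv => ?_, fun U hU _ S hS => ?_⟩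
    · refine le_inf ((cutFilter_mono v inf_le_left).trans (hFcut v hv)) ?_
      rw [le_generate_iff]
      intro S hS
      exact mem_cutFilter_of_determined
        (fun i j hij => h𝒞 S hS i j fun u hu => hij u (hu.trans_lt hv))
        (mem_inf_of_right (mem_generate_of_mem hS))
    · exact hU (mem_inf_of_right (mem_generate_of_mem hS))
  · have hG : genericStep w 𝒞 H = F := by
      simp only [genericStep, dif_pos hH]
      exact if_neg hc
    rw [hG]
    refine ⟨hFne, hFH, hFcut, fun U hU hs => absurd ?_ hc⟩
    intro s hsf hs𝒞
    refine hdec U hU _ (hs s hsf hs𝒞) ?_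
    rintro i j hij ⟨y, hy⟩
    refine ⟨y, fun S hS => h𝒞 S (hs𝒞 hS) _ _ (fun v hv => ?_) (hy S hS)⟩
    rcases hv.eq_or_lt with rfl | hv
    · simp
    · rw [Function.update_of_ne hv.ne, Function.update_of_ne hv.ne, hij v hv]

/-- Let `𝒞 w` be families of subsets of `W → X` that depend on the coordinates up to `w`. There is
an ultrafilter containing every `𝒞 w` for which it contains the projections, along the coordinate
`w`, of all finite intersections of members of `𝒞 w`. -/
theorem exists_generic_ultrafilter [WellFoundedLT W] [Nonempty X] (𝒞 : W → Set (Set (W → X)))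
    (h𝒞 : ∀ w, ∀ S ∈ 𝒞 w, ∀ i j : W → X, (∀ v ≤ w, i v = j v) → i ∈ S → j ∈ S) :
    ∃ U : Ultrafilter (W → X), ∀ w,
      (∀ s : Set (Set (W → X)), s.Finite → s ⊆ 𝒞 w →
        {i | ∃ y, Function.update i w y ∈ ⋂₀ s} ∈ U) → ∀ S ∈ 𝒞 w, S ∈ U := by
  set G := genericFilter 𝒞 with hG
  -- The filters form a decreasing chain, so an infimum of proper ones is proper.
  have inf_neBot : ∀ (s : Set W), (∀ v ∈ s, (G v).NeBot ∧ ∀ u ∈ s, u < v → G v ≤ G u) →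
      (⨅ v : s, G v).NeBot := by
    intro s hs
    refine iInf_neBot_of_directed (fun a b => ?_) fun v => (hs v v.2).1
    rcases lt_trichotomy (a : W) b with h | h | h
    · exact ⟨b, (hs b b.2).2 a a.2 h, le_rfl⟩
    · exact ⟨a, le_rfl, by rw [h]⟩
    · exact ⟨a, le_rfl, (hs a a.2).2 b b.2 h⟩
  have key : ∀ w, (⨅ v : Iio w, G v).NeBot ∧ cutFilter w (⨅ v : Iio w, G v) ≤ ⨅ v : Iio w, G v := by
    intro w
    induction w using WellFoundedLT.induction with
    | _ w ih =>
    have ih' := fun v (hv : v < w) => genericStep_spec (ih v hv).1 (ih v hv).2 (h𝒞 v)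
    refine ⟨inf_neBot _ fun v hv => ?_, le_iInf fun v => ?_⟩
    · rw [hG, genericFilter_eq]
      exact ⟨(ih' v hv).1, fun u _ hu => (ih' v hv).2.1.trans (iInf_le_of_le ⟨u, hu⟩ le_rfl)⟩
    · refine (cutFilter_mono w (iInf_le _ v)).trans ?_
      rw [hG, genericFilter_eq]
      exact (ih' v v.2).2.2.1 w v.2
  have key' := fun w => genericStep_spec (key w).1 (key w).2 (h𝒞 w)
  have hne : (⨅ v : (Set.univ : Set W), G v).NeBot := inf_neBot _ fun v _ => by
    rw [hG, genericFilter_eq]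
    exact ⟨(key' v).1, fun u _ hu => (key' v).2.1.trans (iInf_le_of_le ⟨u, hu⟩ le_rfl)⟩
  refine ⟨Ultrafilter.of (⨅ v : (Set.univ : Set W), G v), fun w => (key' w).2.2.2 _ ?_⟩
  rw [← genericFilter_eq]
  exact (Ultrafilter.of_le _).trans (iInf_le _ (⟨w, Set.mem_univ w⟩ : (Set.univ : Set W)))

end GenericUltrafilter

/-! ### Ultrapowers that realize types over named tuples -/

section Saturation

variable (L : FirstOrder.Language.{u, u})

/-- `N` realizes types in `θ` variables over `θ` parameters: every set of `L`-formulas, in at most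
`θ` parameters and at most `θ` variables, that is finitely satisfiable in `N` is satisfied in `N`.
-/
def RealizesTypes (N : Type u) [L.Structure N] (θ : Cardinal.{u}) : Prop :=
  ∀ (α β : Type u), #α ≤ θ → #β ≤ θ → ∀ (x : α → N) (p : Set (L.Formula (α ⊕ β))),
    (∀ s : Set (L.Formula (α ⊕ β)), s.Finite → s ⊆ p →
      ∃ y : β → N, ∀ φ ∈ s, φ.Realize (Sum.elim x y)) →
    ∃ y : β → N, ∀ φ ∈ p, φ.Realize (Sum.elim x y)

/-- The arities of the constructors of `Witness`. -/
abbrev witnessArity (K : Type u) : Option (Set (L.Formula ((K × K) ⊕ K))) → Type u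
  | none => PEmpty
  | some _ => K

/-- Names for realizations of types: `Witness.real p f` names a `K`-tuple that satisfies `p`, a set
of formulas about a `K`-tuple over the entries of the `K`-tuples named by `f k`, for `k : K`. There
is one further name, `Witness.base`, of an arbitrary `K`-tuple. -/
abbrev Witness (K : Type u) : Type u :=
  WType (witnessArity L K)

variable {L} {K : Type u}

/-- The name of an arbitrary tuple. -/
def Witness.base : Witness L K :=
  WType.mk none PEmpty.elim

/-- The name of a realization of `p` over the tuples named by `f`. -/
def Witness.real (p : Set (L.Formula ((K × K) ⊕ K))) (f : K → Witness L K) : Witness L K :=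
  WType.mk (some p) f

/-- `a` is one of the names that `b` is built from. -/
def Witness.IsPart (a b : Witness L K) : Prop :=
  ∃ p f k, b = Witness.real p f ∧ a = f k

instance : IsWellFounded (Witness L K) Witness.IsPart := by
  refine ⟨⟨fun a => ?_⟩⟩
  induction a with
  | mk o f ih =>
    refine ⟨_, ?_⟩
    rintro _ ⟨p, f', k, h, rfl⟩
    cases h
    exact ih k

/-- There is an ultrafilter for which the coordinate `Witness.real p f` of a generic family `i` of
tuples satisfies `p` over the coordinates `f k`, whenever `p` is finitely satisfiable there. -/
theorem exists_ultrafilter_witness (M : Type u) [L.Structure M] [Nonempty M] :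
    ∃ U : Ultrafilter (Witness L K → K → M), ∀ (p : Set (L.Formula ((K × K) ⊕ K))) f,
      (∀ s : Set (L.Formula ((K × K) ⊕ K)), s.Finite → s ⊆ p →
        {i : Witness L K → K → M | ∃ y, ∀ φ ∈ s,
          φ.Realize (Sum.elim (fun c => i (f c.1) c.2) y)} ∈ U) →
      ∀ φ ∈ p, {i : Witness L K → K → M |
        φ.Realize (Sum.elim (fun c => i (f c.1) c.2) (i (Witness.real p f)))} ∈ U := by
  let _ : LinearOrder (Witness L K) := IsWellFounded.wellOrderExtension Witness.IsPart
  have : WellFoundedLT (Witness L K) :=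
    IsWellFounded.wellOrderExtension.isWellFounded_lt Witness.IsPart
  have hlt : ∀ (p : Set (L.Formula ((K × K) ⊕ K))) (f : K → Witness L K) k,
      f k < Witness.real p f := fun p f k =>
    Prod.Lex.left _ _ (IsWellFounded.rank_lt_of_rel (r := Witness.IsPart) ⟨p, f, k, rfl, rfl⟩)
  let S : (K → Witness L K) → Witness L K → L.Formula ((K × K) ⊕ K) → Set (Witness L K → K → M) :=
    fun f w φ => {i | φ.Realize (Sum.elim (fun c => i (f c.1) c.2) (i w))}
  obtain ⟨U, hU⟩ := exists_generic_ultrafilter (X := K → M)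
    (fun w : Witness L K => {R | ∃ p f, w = Witness.real p f ∧ ∃ φ ∈ p, R = S f w φ}) (by
      rintro _ _ ⟨p, f, rfl, φ, -, rfl⟩ i j hij hi
      have h1 : j (Witness.real p f) = i (Witness.real p f) := (hij _ le_rfl).symm
      have h2 : ∀ k, j (f k) = i (f k) := fun k => (hij _ (hlt p f k).le).symm
      simpa [S, h1, h2] using hi)
  refine ⟨U, fun p f h φ hφ => hU (Witness.real p f) (fun s hs hsp => ?_) _
    ⟨p, f, rfl, φ, hφ, rfl⟩⟩
  have hsp' : s ⊆ S f (Witness.real p f) '' p := by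
    intro R hR
    obtain ⟨p', f', h', φ, hφ, rfl⟩ := hsp hR
    cases h'
    exact ⟨φ, hφ, rfl⟩
  obtain ⟨t, htp, htf, rfl⟩ := Set.exists_subset_image_finite_and
    (p := fun t => t = s) |>.1 ⟨s, hsp', hs, rfl⟩
  refine Filter.mem_of_superset (h t htf htp) ?_
  rintro i ⟨y, hy⟩
  refine ⟨y, ?_⟩
  rintro _ ⟨φ, hφ, rfl⟩
  have h2 : ∀ k, Function.update i (Witness.real p f) y (f k) = i (f k) := fun k =>
    Function.update_of_ne (hlt p f k).ne _ _
  simpa [S, h2] using hy φ hφ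

/-- Some ultrapower of `M` has a subset, indexed by `Witness L K × K`, in which all types over
`K`-tuples from this subset are realized. -/
theorem exists_ultrapower_realizing (M : Type u) [L.Structure M] [Nonempty M] :
    ∃ (N : Type u) (_ : L.Structure N) (e : Witness L K → K → N), Nonempty N ∧ (M ≅[L] N) ∧
      ∀ (b : K → Witness L K) (c : K → K) (p : Set (L.Formula (K ⊕ K))),
        (∀ s : Set (L.Formula (K ⊕ K)), s.Finite → s ⊆ p → ∃ y : K → N, ∀ φ ∈ s,
          φ.Realize (Sum.elim (fun k => e (b k) (c k)) y)) →
        ∃ w, ∀ φ ∈ p, φ.Realize (Sum.elim (fun k => e (b k) (c k)) (e w)) := by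
  obtain ⟨U, hU⟩ := exists_ultrafilter_witness (L := L) (K := K) M
  let N := (U : Filter (Witness L K → K → M)).Product (fun _ => M)
  let q : ((Witness L K → K → M) → M) → N := fun x => (x : N)
  have hq : Function.Surjective q := Quotient.mk''_surjective
  have hlos : ∀ {γ : Type u} (φ : L.Formula γ) (x : γ → (Witness L K → K → M) → M),
      φ.Realize (q ∘ x) ↔ {i | φ.Realize (fun g => x g i)} ∈ U := fun φ x =>
    Ultraproduct.realize_formula_cast φ x
  refine ⟨N, inferInstance, fun w k => q fun i => i w k, inferInstance, ?_, ?_⟩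
  · rw [elementarilyEquivalent_iff]
    intro φ
    rw [Ultraproduct.sentence_realize]
    simp
  intro b c p hp
  let r : L.Formula (K ⊕ K) → L.Formula ((K × K) ⊕ K) :=
    Formula.relabel (Sum.map (fun k => (k, c k)) id)
  have hr : ∀ (φ : L.Formula (K ⊕ K)) (i : Witness L K → K → M) (y : K → M),
      (r φ).Realize (Sum.elim (fun d : K × K => i (b d.1) d.2) y) ↔
        φ.Realize (Sum.elim (fun k => i (b k) (c k)) y) := by
    intro φ i y
    rw [Formula.realize_relabel]
    refine iff_of_eq (congrArg _ (funext fun z => ?_))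
    rcases z with z | z <;> rfl
  have hel : ∀ y : K → (Witness L K → K → M) → M,
      Sum.elim (fun k => q fun i => i (b k) (c k)) (q ∘ y) =
        q ∘ Sum.elim (fun k i => i (b k) (c k)) y := by
    intro y
    funext z
    rcases z with z | z <;> rfl
  have hel' : ∀ (y : K → (Witness L K → K → M) → M) i,
      (fun g => Sum.elim (fun k (i : Witness L K → K → M) => i (b k) (c k)) y g i) =
        Sum.elim (fun k => i (b k) (c k)) (fun k => y k i) := by
    intro y i
    funext z
    rcases z with z | z <;> rfl
  refine ⟨Witness.real (r '' p) b, fun φ hφ => ?_⟩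
  have := hU (r '' p) b (fun s hs hsp => ?_) (r φ) ⟨φ, hφ, rfl⟩
  · refine (iff_of_eq (congrArg _ (hel fun k i => i (Witness.real (r '' p) b) k))).2 ?_
    refine (hlos φ _).2 ?_
    simp only [hel']
    simpa only [hr] using this
  · obtain ⟨t, htp, htf, rfl⟩ := Set.exists_subset_image_finite_and
      (p := fun t => t = s) |>.1 ⟨s, hsp, hs, rfl⟩
    obtain ⟨y, hy⟩ := hp t htf htp
    choose y' hy' using fun k => hq (y k)
    obtain rfl : q ∘ y' = y := funext hy'
    have : ∀ φ ∈ t, {i | φ.Realize (Sum.elim (fun k => i (b k) (c k)) (fun k => y' k i))} ∈ U := by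
      intro φ hφ
      have := hy φ hφ
      rw [hel, hlos] at this
      simpa only [hel'] using this
    refine Filter.mem_of_superset ((Filter.biInter_mem htf).2 this) fun i hi =>
      ⟨fun k => y' k i, ?_⟩
    rintro _ ⟨φ, hφ, rfl⟩
    exact (hr φ i _).2 (Set.mem_iInter₂.1 hi φ hφ)

end Saturation

/-! ### Saturated models of bounded size -/

section SmallSaturated

variable {L : FirstOrder.Language.{u, u}}

theorem card_formula_le {α : Type u} {θ : Cardinal.{u}} (hθ : ℵ₀ ≤ θ) (hL : L.card ≤ θ)
    (hα : #α ≤ θ) : #(L.Formula α) ≤ θ := by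
  have h1 : #(L.Formula α) ≤ #(Σ n, L.BoundedFormula α n) :=
    mk_le_of_injective (f := fun φ => ⟨0, φ⟩) fun φ ψ h => by simpa using h
  refine h1.trans (BoundedFormula.card_le.trans (max_le hθ ?_))
  simpa using add_le_of_le hθ hα hL

theorem card_witness_prod_le {K : Type u} (hK : ℵ₀ ≤ #K) (hL : L.card ≤ #K) :
    #(Witness L K × K) ≤ 2 ^ #K := by
  have hF : #(L.Formula ((K × K) ⊕ K)) ≤ #K := by
    refine card_formula_le hK hL ?_
    simp [mul_eq_self hK, add_eq_self hK]
  have h2 : ℵ₀ ≤ (2 : Cardinal.{u}) ^ #K := hK.trans (cantor _).le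
  have hW : #(Witness L K) ≤ 2 ^ #K := by
    refine WType.cardinalMk_le_of_le ?_
    refine (sum_le_mk_mul_iSup _).trans ((mul_le_mul' ?_ (ciSup_le' (a := 2 ^ #K) ?_)).trans
      (mul_eq_self h2).le)
    · rw [mk_option, mk_set]
      exact add_le_of_le h2 (power_le_power_left two_ne_zero hF) (one_le_aleph0.trans h2)
    · rintro (_ | p)
      · simpa using one_le_aleph0.trans h2
      · exact (power_mul ▸ (mul_eq_self hK).symm ▸ le_rfl : ((2 : Cardinal.{u}) ^ #K) ^ #K ≤ 2 ^ #K)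
  rw [mk_prod, lift_id, lift_id]
  exact (mul_le_mul' hW (cantor _).le).trans (mul_eq_self h2).le

/-- Every structure is elementarily equivalent to one of size at most `2 ^ θ` that realizes types in
`θ` variables over `θ` parameters: inside the ultrapower, the elements named by witnesses form an
elementary substructure. -/
theorem exists_realizesTypes (M : Type u) [L.Structure M] [Nonempty M] {θ : Cardinal.{u}}
    (hθ : ℵ₀ ≤ θ) (hL : L.card ≤ θ) :
    ∃ (N : Type u) (_ : L.Structure N), Nonempty N ∧ (M ≅[L] N) ∧ #N ≤ 2 ^ θ ∧
      RealizesTypes L N θ := by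
  induction θ using Cardinal.inductionOn with | _ K
  obtain ⟨N, _, e, _, hMN, he⟩ := exists_ultrapower_realizing (L := L) (K := K) M
  have : Infinite K := infinite_iff.2 hθ
  obtain ⟨k₀⟩ : Nonempty K := inferInstance
  let R : Set N := Set.range fun a : Witness L K × K => e a.1 a.2
  have hR : ∀ (α β : Type u), #α ≤ #K → #β ≤ #K → ∀ (x : α → N), (∀ a, x a ∈ R) →
      ∀ p : Set (L.Formula (α ⊕ β)), (∀ s : Set (L.Formula (α ⊕ β)), s.Finite → s ⊆ p →
        ∃ y : β → N, ∀ φ ∈ s, φ.Realize (Sum.elim x y)) →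
      ∃ y : β → N, (∀ b, y b ∈ R) ∧ ∀ φ ∈ p, φ.Realize (Sum.elim x y) := by
    rintro α β ⟨f⟩ ⟨g⟩ x hx p hp
    choose x' hx' using hx
    let d : K → Witness L K × K := Function.extend f x' fun _ => (Witness.base, k₀)
    have hd : ∀ a, d (f a) = x' a := fun a => f.injective.extend_apply _ _ a
    let r : L.Formula (α ⊕ β) → L.Formula (K ⊕ K) := Formula.relabel (Sum.map f g)
    have hr : ∀ (φ : L.Formula (α ⊕ β)) (y : K → N),
        (r φ).Realize (Sum.elim (fun k => e (d k).1 (d k).2) y) ↔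
          φ.Realize (Sum.elim x (y ∘ g)) := by
      intro φ y
      rw [Formula.realize_relabel]
      refine iff_of_eq (congrArg _ (funext fun z => ?_))
      rcases z with z | z
      · simp [hd, ← hx']
      · rfl
    obtain ⟨w, hw⟩ := he (fun k => (d k).1) (fun k => (d k).2) (r '' p) (by
      intro s hs hsp
      obtain ⟨t, htp, htf, rfl⟩ := Set.exists_subset_image_finite_and
        (p := fun t => t = s) |>.1 ⟨s, hsp, hs, rfl⟩
      obtain ⟨y, hy⟩ := hp t htf htp
      refine ⟨Function.extend g y fun _ => e Witness.base k₀, ?_⟩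
      rintro _ ⟨φ, hφ, rfl⟩
      rw [hr, Function.extend_comp g.injective]
      exact hy φ hφ)
    exact ⟨e w ∘ g, fun b => ⟨(w, g b), rfl⟩, fun φ hφ => (hr φ _).1 (hw _ ⟨φ, hφ, rfl⟩)⟩
  have hfin : ∀ n : ℕ, #(ULift.{u} (Fin n)) ≤ #K := fun n =>
    (lt_aleph0_of_finite _).le.trans hθ
  have hone : #(PUnit.{u + 1}) ≤ #K := (lt_aleph0_of_finite _).le.trans hθ
  -- The set `R` is closed under the operations and satisfies the Tarski-Vaught criterion.
  have hR₁ : ∀ (n : ℕ) (φ : L.Formula (Fin n ⊕ Unit)) (x : Fin n → N), (∀ i, x i ∈ R) →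
      ∀ a : N, φ.Realize (Sum.elim x fun _ => a) → ∃ b ∈ R, φ.Realize (Sum.elim x fun _ => b) := by
    intro n φ x hx a ha
    have hrel : ∀ y : PUnit.{u + 1} → N,
        (Formula.relabel (Sum.map ULift.up.{u} fun _ => PUnit.unit.{u + 1}) φ).Realize
          (Sum.elim (x ∘ ULift.down) y) ↔ φ.Realize (Sum.elim x fun _ => y PUnit.unit) := by
      intro y
      rw [Formula.realize_relabel]
      refine iff_of_eq (congrArg _ (funext fun z => ?_))
      rcases z with z | z <;> rfl
    obtain ⟨y, hyR, hy⟩ := hR (ULift.{u} (Fin n)) PUnit.{u + 1} (hfin n) hone (x ∘ ULift.down)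
      (fun i => hx _) {Formula.relabel (Sum.map ULift.up.{u} fun _ => PUnit.unit.{u + 1}) φ}
      (fun s _ hs => ⟨fun _ => a, fun ψ hψ => by
        rw [hs hψ, hrel]
        exact ha⟩)
    exact ⟨y PUnit.unit, hyR _, (hrel y).1 (hy _ rfl)⟩
  let S : L.Substructure N := ⟨R, fun {n} F x hx => by
    obtain ⟨b, hb, hFb⟩ := hR₁ n
      (((Functions.term F).relabel Sum.inl).equal (Term.var (Sum.inr ()))) x hx
      (Structure.funMap F x) (by
        simp [Formula.realize_equal, Term.realize_relabel, Function.comp_def])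
    simp only [Formula.realize_equal, Term.realize_relabel, Function.comp_def, Sum.elim_inl,
      Term.realize_function_term, Term.realize_var, Sum.elim_inr] at hFb
    rwa [hFb]⟩
  have hS : S.IsElementary := S.isElementary_of_exists fun n φ x a ha => by
    let c : Empty ⊕ Fin (n + 1) → Fin n ⊕ Unit :=
      Sum.elim Empty.elim (Fin.snoc Sum.inl (Sum.inr ()) : Fin (n + 1) → Fin n ⊕ Unit)
    have hc : ∀ b : N, (φ.toFormula.relabel c).Realize (Sum.elim ((↑) ∘ x) fun _ => b) ↔
        φ.Realize default (Fin.snoc ((↑) ∘ x) b : Fin (n + 1) → N) := by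
      intro b
      rw [Formula.realize_relabel, BoundedFormula.realize_toFormula]
      refine iff_of_eq (congrArg₂ _ (Subsingleton.elim _ _) (funext fun i => ?_))
      refine Fin.lastCases ?_ (fun j => ?_) i <;> simp [c]
    obtain ⟨b, hb, h⟩ := hR₁ n (φ.toFormula.relabel c) (fun i => (x i : N))
      (fun i => (x i).2) a ((hc a).2 ha)
    exact ⟨⟨b, hb⟩, (hc b).1 h⟩
  let S' : L.ElementarySubstructure N := ⟨S, hS⟩
  refine ⟨S', inferInstance, inferInstance, hMN.trans S'.elementarilyEquivalent.symm, ?_, ?_⟩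
  · exact mk_range_le.trans (card_witness_prod_le hθ hL)
  · intro α β hα hβ x p hp
    have hx : ∀ y : β → S', Sum.elim (fun a => (x a : N)) (fun b => (y b : N)) =
        S'.subtype ∘ Sum.elim x y := by
      intro y
      funext z
      rcases z with z | z <;> rfl
    obtain ⟨y, hyR, hy⟩ := hR α β hα hβ (fun a => (x a : N)) (fun a => (x a).2) p (by
      intro s hs hsp
      obtain ⟨y, hy⟩ := hp s hs hsp
      refine ⟨fun b => y b, fun φ hφ => ?_⟩
      rw [hx, S'.subtype.map_formula]
      exact hy φ hφ)
    refine ⟨fun b => ⟨y b, hyR b⟩, fun φ hφ => ?_⟩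
    rw [← S'.subtype.map_formula, ← hx fun b => ⟨y b, hyR b⟩]
    exact hy φ hφ

end SmallSaturated

/-! ### Types over sets and saturation -/

section Types

variable {L : FirstOrder.Language.{u, u}}

/-- Only finitely many of the variables of a formula matter. -/
theorem exists_formula_finite_variables {α : Type*} {ι : Type*} (φ : L.Formula (α ⊕ ι)) :
    ∃ (m : ℕ) (s : Fin m → ι) (ψ : L.Formula (α ⊕ Fin m)), Function.Injective s ∧
      ∀ (M : Type u) [L.Structure M] (x : α → M) (y : ι → M),
        φ.Realize (Sum.elim x y) ↔ ψ.Realize (Sum.elim x (y ∘ s)) := by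
  classical
  let F := (BoundedFormula.freeVarFinset φ).toRight
  let e := F.equivFin
  refine ⟨F.card, fun i => (e.symm i : ι), BoundedFormula.restrictFreeVar φ fun z => match z with
    | ⟨Sum.inl a, _⟩ => Sum.inl a
    | ⟨Sum.inr i, h⟩ => Sum.inr (e ⟨i, Finset.mem_toRight.2 h⟩),
    Subtype.val_injective.comp e.symm.injective, fun M _ x y => ?_⟩
  refine (BoundedFormula.realize_restrictFreeVar (Sum.elim x y) ?_).symm
  rintro ⟨a | i, h⟩ <;> simp

/-- The form of `exists_formula_finite_variables` without parameters. -/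
theorem exists_formula_finite_variables' {ι : Type*} (φ : L.Formula ι) :
    ∃ (m : ℕ) (s : Fin m → ι) (ψ : L.Formula (Fin m)),
      ∀ (M : Type u) [L.Structure M] (y : ι → M), φ.Realize y ↔ ψ.Realize (y ∘ s) := by
  obtain ⟨m, s, ψ, -, h⟩ := exists_formula_finite_variables
    (Formula.relabel (Sum.inr : ι → Empty ⊕ ι) φ)
  refine ⟨m, s, Formula.relabel (Sum.elim Empty.elim id) ψ, fun M _ y => ?_⟩
  have := h M Empty.elim y
  rw [Formula.realize_relabel, Sum.elim_comp_inr] at this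
  rw [this, Formula.realize_relabel]
  refine iff_of_eq (congrArg _ (funext fun z => ?_))
  rcases z with z | z
  · exact z.elim
  · rfl

/-- Members of types over `A` may be presented as formulas with variables for the parameters. -/
theorem exists_eq_equivSentence {A : Type u} {ι : Type w} (φ : L[[A]][[ι]].Sentence) :
    ∃ ψ : L.Formula (A ⊕ ι),
      φ = Formula.equivSentence (BoundedFormula.constantsVarsEquiv.symm ψ : L[[A]].Formula ι) :=
  ⟨BoundedFormula.constantsVarsEquiv (Formula.equivSentence.symm φ), by simp⟩

variable {M : Type u} [L.Structure M] [Nonempty M]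

theorem mem_tp_iff {A : Set M} {ι : Type w} {v : ι → M} (φ : L.Formula (A ⊕ ι)) :
    Formula.equivSentence (BoundedFormula.constantsVarsEquiv.symm φ : L[[A]].Formula ι) ∈ tp L A v ↔
      φ.Realize (Sum.elim (↑) v) := by
  rw [tp, Theory.CompleteType.formula_mem_typeOf]
  refine BoundedFormula.realize_constantsVarsEquiv.symm.trans ?_
  rw [Equiv.apply_symm_apply]
  rfl

theorem tp_eq_iff {A : Set M} {ι : Type w} {v : ι → M} {q : TypesOver L A ι} :
    tp L A v = q ↔ ∀ φ : L.Formula (A ⊕ ι), Formula.equivSentence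
      (BoundedFormula.constantsVarsEquiv.symm φ : L[[A]].Formula ι) ∈ q →
        φ.Realize (Sum.elim (↑) v) := by
  refine ⟨fun h φ hφ => ?_, fun h => ?_⟩
  · rwa [← h, mem_tp_iff] at hφ
  · refine SetLike.ext fun φ => ⟨fun hφ => ?_, fun hφ => ?_⟩
    · by_contra hq
      obtain ⟨ψ, hψ⟩ := exists_eq_equivSentence φ.not
      have h1 := (Theory.CompleteType.not_mem_iff q φ).2 hq
      rw [hψ] at h1
      have h2 := (mem_tp_iff ψ).2 (h ψ h1)
      rw [← hψ] at h2
      exact (Theory.CompleteType.not_mem_iff _ φ).1 h2 hφ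
    · obtain ⟨ψ, rfl⟩ := exists_eq_equivSentence φ
      exact (mem_tp_iff ψ).2 (h ψ hφ)

theorem tp_eq_tp_iff {A : Set M} {ι : Type w} {v v' : ι → M} :
    tp L A v = tp L A v' ↔
      ∀ φ : L.Formula (A ⊕ ι), φ.Realize (Sum.elim (↑) v) ↔ φ.Realize (Sum.elim (↑) v') := by
  refine ⟨fun h φ => by rw [← mem_tp_iff, h, mem_tp_iff], fun h => tp_eq_iff.2 fun φ hφ => ?_⟩
  rwa [mem_tp_iff, ← h] at hφ

/-- A complete type over `A` is finitely satisfiable in `M`. -/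
theorem exists_realize_of_mem {A : Set M} {k : ℕ} (q : TypesOver L A (Fin k))
    {s : Set (L.Formula (A ⊕ Fin k))} (hs : s.Finite)
    (hq : ∀ φ ∈ s, Formula.equivSentence
      (BoundedFormula.constantsVarsEquiv.symm φ : L[[A]].Formula (Fin k)) ∈ q) :
    ∃ y : Fin k → M, ∀ φ ∈ s, φ.Realize (Sum.elim (↑) y) := by
  obtain ⟨N, v, hv⟩ := Theory.exists_modelType_is_realized_in _ q
  have := hs.to_subtype
  let f : s → L[[A]].Formula (Fin k) := fun φ => BoundedFormula.constantsVarsEquiv.symm φ.1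
  let χ : L[[A]].Sentence := Formula.iExs (Fin k)
    (Formula.relabel (Sum.inr : Fin k → Empty ⊕ Fin k) (Formula.iInf f))
  have hχ : N ⊨ χ := by
    refine Formula.realize_iExs.2 ⟨v, ?_⟩
    rw [Formula.realize_relabel, Sum.elim_comp_inr, Formula.realize_iInf]
    rintro ⟨φ, hφ⟩
    rw [← Theory.CompleteType.formula_mem_typeOf (T := L[[A]].completeTheory M), hv]
    exact hq φ hφ
  have hχM : M ⊨ χ := (realize_iff_of_model_completeTheory M N χ).1 hχ
  obtain ⟨y, hy⟩ := Formula.realize_iExs.1 hχM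
  rw [Formula.realize_relabel, Sum.elim_comp_inr, Formula.realize_iInf] at hy
  refine ⟨y, fun φ hφ => ?_⟩
  rw [← mem_tp_iff, tp, Theory.CompleteType.formula_mem_typeOf]
  exact hy ⟨φ, hφ⟩

theorem RealizesTypes.isSaturated {θ l : Cardinal.{u}} (h : RealizesTypes L M θ) (hθ : ℵ₀ ≤ θ)
    (hl : l ≤ θ) : IsSaturated L M l := by
  intro A hA q
  have hone : #(ULift.{u} (Fin 1)) ≤ θ := (lt_aleph0_of_finite _).le.trans hθ
  let r : L.Formula (A ⊕ Fin 1) → L.Formula (A ⊕ ULift.{u} (Fin 1)) :=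
    Formula.relabel (Sum.map id ULift.up)
  have hr : ∀ φ (y : ULift.{u} (Fin 1) → M),
      (r φ).Realize (Sum.elim (↑) y) ↔ φ.Realize (Sum.elim (↑) (y ∘ ULift.up)) := by
    intro φ y
    rw [Formula.realize_relabel]
    refine iff_of_eq (congrArg _ (funext fun z => ?_))
    rcases z with z | z <;> rfl
  obtain ⟨y, hy⟩ := h A (ULift.{u} (Fin 1)) (hA.le.trans hl) hone (↑) (r '' {φ |
    Formula.equivSentence (BoundedFormula.constantsVarsEquiv.symm φ : L[[A]].Formula (Fin 1)) ∈ q})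
    (by
      intro s hs hsp
      obtain ⟨t, htp, htf, rfl⟩ := Set.exists_subset_image_finite_and
        (p := fun t => t = s) |>.1 ⟨s, hsp, hs, rfl⟩
      obtain ⟨y, hy⟩ := exists_realize_of_mem q htf htp
      refine ⟨y ∘ ULift.down, ?_⟩
      rintro _ ⟨φ, hφ, rfl⟩
      exact (hr φ _).2 (hy φ hφ))
  exact ⟨y ∘ ULift.up, tp_eq_iff.2 fun φ hφ => (hr φ y).1 (hy _ ⟨φ, hφ, rfl⟩)⟩

/-- In a `μ`-saturated structure, finitely satisfiable sets of formulas in one variable over fewer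
than `μ` parameters are satisfied. -/
theorem IsSaturated.exists_realize {μ : Cardinal.{u}} (h : IsSaturated L M μ) {ι : Type u}
    (hι : #ι < μ) (x : ι → M) (p : Set (L.Formula (ι ⊕ Fin 1)))
    (hp : ∀ s : Set (L.Formula (ι ⊕ Fin 1)), s.Finite → s ⊆ p →
      ∃ c : M, ∀ φ ∈ s, φ.Realize (Sum.elim x fun _ => c)) :
    ∃ c : M, ∀ φ ∈ p, φ.Realize (Sum.elim x fun _ => c) := by
  let A := Set.range x
  let r : L.Formula (ι ⊕ Fin 1) → L.Formula (A ⊕ Fin 1) :=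
    Formula.relabel (Sum.map (Set.rangeFactorization x) id)
  have hr : ∀ φ (y : Fin 1 → M),
      (r φ).Realize (Sum.elim (↑) y) ↔ φ.Realize (Sum.elim x y) := by
    intro φ y
    rw [Formula.realize_relabel]
    refine iff_of_eq (congrArg _ (funext fun z => ?_))
    rcases z with z | z <;> rfl
  let t : p → Set (TypesOver L A (Fin 1)) := fun φ =>
    Theory.typesWith _ (Formula.equivSentence
      (BoundedFormula.constantsVarsEquiv.symm (r φ) : L[[A]].Formula (Fin 1)))
  obtain ⟨q, -, hq⟩ := isCompact_univ.inter_iInter_nonempty t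
    (fun φ => CompleteType.isClosed_typesWith _) (by
      intro s
      obtain ⟨c, hc⟩ := hp ((↑) '' (s : Set p)) (s.finite_toSet.image _) (by
        rintro _ ⟨φ, -, rfl⟩
        exact φ.2)
      refine ⟨tp L A fun _ => c, trivial, Set.mem_iInter₂.2 fun φ hφ => ?_⟩
      exact (mem_tp_iff _).2 ((hr _ _).2 (hc _ ⟨φ, hφ, rfl⟩)))
  obtain ⟨c, rfl⟩ := h A (mk_range_le.trans_lt hι) q
  refine ⟨c 0, fun φ hφ => ?_⟩
  have := (hr φ c).1 ((mem_tp_iff _).1 (Set.mem_iInter.1 hq ⟨φ, hφ⟩))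
  rwa [show c = fun _ => c 0 from funext fun i => by rw [Subsingleton.elim i 0] ] at this

end Types

/-! ### Extension of partial elementary maps -/

section Graphs

variable {L : FirstOrder.Language.{u, u}} {M N : Type u} [L.Structure M] [L.Structure N]

variable (L) in
/-- `G ⊆ M × N` is (the graph of) a partial elementary map: finite tuples of pairs from `G` have
first and second coordinates of the same type. -/
def IsElementaryGraph (G : Set (M × N)) : Prop :=
  ∀ (m : ℕ) (φ : L.Formula (Fin m)) (g : Fin m → M × N), (∀ i, g i ∈ G) →
    (φ.Realize (Prod.fst ∘ g) ↔ φ.Realize (Prod.snd ∘ g))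

theorem IsElementaryGraph.realize_iff {G : Set (M × N)} (hG : IsElementaryGraph L G) {ι : Type*}
    (g : ι → M × N) (hg : ∀ i, g i ∈ G) (φ : L.Formula ι) :
    φ.Realize (Prod.fst ∘ g) ↔ φ.Realize (Prod.snd ∘ g) := by
  obtain ⟨m, s, ψ, hψ⟩ := exists_formula_finite_variables' φ
  rw [hψ, hψ]
  exact hG m ψ (g ∘ s) fun i => hg _

theorem IsElementaryGraph.mono {G H : Set (M × N)} (hG : IsElementaryGraph L G) (h : H ⊆ G) :
    IsElementaryGraph L H :=
  fun m φ g hg => hG m φ g fun i => h (hg i)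

theorem isElementaryGraph_range {ι : Type*} {x : ι → M} {y : ι → N}
    (h : ∀ φ : L.Formula ι, φ.Realize x ↔ φ.Realize y) :
    IsElementaryGraph L (Set.range fun i => (x i, y i)) := by
  intro m φ g hg
  choose s hs using hg
  obtain rfl : (fun i => (x (s i), y (s i))) = g := funext hs
  have := h (φ.relabel s)
  rwa [Formula.realize_relabel, Formula.realize_relabel] at this

theorem IsElementaryGraph.fst_injOn {G : Set (M × N)} (hG : IsElementaryGraph L G) :
    Set.InjOn Prod.fst G := by
  intro a ha b hb hab
  have := hG 2 ((Term.var 0 : L.Term (Fin 2)).equal (Term.var 1)) ![a, b] (by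
    intro i
    fin_cases i
    exacts [ha, hb])
  simp only [Formula.realize_equal, Term.realize_var, Function.comp_apply, Matrix.cons_val_zero,
    Matrix.cons_val_one] at this
  exact Prod.ext hab (this.1 hab)

theorem IsElementaryGraph.mk_le {G : Set (M × N)} (hG : IsElementaryGraph L G) {C : Set M}
    (hC : ∀ g ∈ G, g.1 ∈ C) : #G ≤ #C :=
  mk_le_of_injective (f := fun g : G => (⟨g.1.1, hC g g.2⟩ : C)) fun a b h =>
    Subtype.ext (hG.fst_injOn a.2 b.2 (congrArg Subtype.val h))

/-- If partial elementary maps extending `G₀`, with new elements from `C` and new values in `Y`, can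
be extended to any single element of `C` with a value in `Y`, then `G₀` can be extended to all of
`C` at once. -/
theorem IsElementaryGraph.exists_extension {G₀ : Set (M × N)} (hG₀ : IsElementaryGraph L G₀)
    (C : Set M) (Y : Set N)
    (step : ∀ G, G₀ ⊆ G → G ⊆ G₀ ∪ C ×ˢ Y → IsElementaryGraph L G → ∀ c ∈ C, ∃ d ∈ Y,
      IsElementaryGraph L (insert (c, d) G)) :
    ∃ G, G₀ ⊆ G ∧ G ⊆ G₀ ∪ C ×ˢ Y ∧ IsElementaryGraph L G ∧ ∀ c ∈ C, ∃ d ∈ Y, (c, d) ∈ G := by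
  obtain ⟨G, hG₀G, hG⟩ := zorn_subset_nonempty
    {G : Set (M × N) | G ⊆ G₀ ∪ C ×ˢ Y ∧ IsElementaryGraph L G} (fun c hc hchain hne => by
      refine ⟨⋃₀ c, ⟨Set.sUnion_subset fun s hs => (hc hs).1, fun m φ g hg => ?_⟩,
        fun s hs => Set.subset_sUnion_of_mem hs⟩
      obtain ⟨t, ht, hgt⟩ := hchain.directedOn.exists_mem_subset_of_finite_of_subset_sUnion hne
        (Set.finite_range g) (by rintro _ ⟨i, rfl⟩; exact hg i)
      exact (hc ht).2 m φ g fun i => hgt ⟨i, rfl⟩)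
    G₀ ⟨Set.subset_union_left, hG₀⟩
  refine ⟨G, hG₀G, hG.prop.1, hG.prop.2, fun c hc => ?_⟩
  obtain ⟨d, hd, hcd⟩ := step G hG₀G hG.prop.1 hG.prop.2 c hc
  exact ⟨d, hd, hG.mem_of_prop_insert
    ⟨Set.insert_subset (Or.inr ⟨hc, hd⟩) hG.prop.1, hcd⟩⟩

theorem isElementaryGraph_insert {G : Set (M × N)} {c : M} {d : N}
    (h : ∀ φ : L.Formula (G ⊕ Fin 1), φ.Realize (Sum.elim (fun g => g.1.1) fun _ => c) →
      φ.Realize (Sum.elim (fun g => g.1.2) fun _ => d)) :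
    IsElementaryGraph L (insert (c, d) G) := by
  refine (isElementaryGraph_range (L := L) (ι := G ⊕ Fin 1)
    (x := Sum.elim (fun g => g.1.1) fun _ => c) (y := Sum.elim (fun g => g.1.2) fun _ => d)
    fun φ => ⟨h φ, fun hφ => ?_⟩).mono ?_
  · by_contra hc
    exact h φ.not hc hφ
  · rintro g (rfl | hg)
    · exact ⟨Sum.inr 0, rfl⟩
    · exact ⟨Sum.inl ⟨g, hg⟩, rfl⟩

/-- The one-step extension of a partial elementary map into a saturated structure. -/
theorem IsElementaryGraph.exists_insert [Nonempty N] {μ : Cardinal.{u}} (hN : IsSaturated L N μ)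
    {G : Set (M × N)} (hG : IsElementaryGraph L G) (hμ : #G < μ) (c : M) :
    ∃ d : N, IsElementaryGraph L (insert (c, d) G) := by
  obtain ⟨d, hd⟩ := hN.exists_realize hμ (fun g : G => g.1.2)
    {φ | φ.Realize (Sum.elim (fun g => g.1.1) fun _ => c)} (by
      intro s hs hsp
      have := hs.to_subtype
      let χ : L.Formula G := Formula.iExs (Fin 1) (Formula.iInf fun φ : s => φ.1)
      have hχ : χ.Realize (Prod.fst ∘ ((↑) : G → M × N)) :=
        Formula.realize_iExs.2 ⟨fun _ => c, Formula.realize_iInf.2 fun φ => hsp φ.2⟩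
      obtain ⟨d, hd⟩ := Formula.realize_iExs.1 ((hG.realize_iff _ (fun g => g.2) χ).1 hχ)
      refine ⟨d 0, fun φ hφ => ?_⟩
      have := Formula.realize_iInf.1 hd ⟨φ, hφ⟩
      rwa [show d = fun _ => d 0 from funext fun i => by rw [Subsingleton.elim i 0] ] at this)
  exact ⟨d, isElementaryGraph_insert fun φ hφ => hd φ hφ⟩

/-- A small structure elementarily equivalent to a saturated one embeds elementarily in it. -/
theorem IsSaturated.exists_elementaryEmbedding [Nonempty N] {μ : Cardinal.{u}}
    (hN : IsSaturated L N μ) (hM : #M < μ) (hMN : M ≅[L] N) : Nonempty (M ↪ₑ[L] N) := by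
  have h₀ : IsElementaryGraph L (∅ : Set (M × N)) := by
    refine (isElementaryGraph_range (L := L) (x := (Empty.elim : Empty → M))
      (y := (Empty.elim : Empty → N)) fun φ => ?_).mono (Set.empty_subset _)
    have := elementarilyEquivalent_iff.1 hMN φ
    rwa [Sentence.Realize, Sentence.Realize, Subsingleton.elim (default : Empty → M) Empty.elim,
      Subsingleton.elim (default : Empty → N) Empty.elim] at this
  obtain ⟨G, -, -, hG, h⟩ := h₀.exists_extension Set.univ Set.univ (fun G _ _ hG c _ => by
    obtain ⟨d, hd⟩ := hG.exists_insert hN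
      (((hG.mk_le (C := Set.univ) fun _ _ => trivial).trans_eq mk_univ).trans_lt hM) c
    exact ⟨d, trivial, hd⟩)
  choose f _ hf using fun c => h c trivial
  exact ⟨⟨f, fun n φ x => (hG n φ (fun i => (x i, f (x i))) fun i => hf _).symm⟩⟩

/-- In a strongly `μ`-homogeneous structure, small partial elementary maps are restrictions of
automorphisms. -/
theorem IsStronglyHomogeneous.exists_equiv {μ : Cardinal.{u}} (hM : IsStronglyHomogeneous L M μ)
    {G : Set (M × M)} (hG : IsElementaryGraph L G) (hμ : #G < μ) :
    ∃ σ : M ≃[L] M, ∀ g ∈ G, σ g.1 = g.2 := by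
  choose f hf using fun a : (Prod.fst '' G) => a.2
  obtain ⟨σ, hσ⟩ := hM (Prod.fst '' G) (fun a => (f a).2) (mk_image_le.trans_lt hμ) (fun φ => by
    have := hG.realize_iff f (fun a => (hf a).1) φ
    rw [show Prod.fst ∘ f = ((↑) : _ → M) from funext fun a => (hf a).2] at this
    exact this.symm)
  refine ⟨σ, fun g hg => ?_⟩
  have ha : g.1 ∈ Prod.fst '' G := ⟨g, hg, rfl⟩
  rw [show g.1 = (⟨g.1, ha⟩ : (Prod.fst '' G)).1 from rfl, hσ,
    hG.fst_injOn (hf ⟨g.1, ha⟩).1 hg (hf ⟨g.1, ha⟩).2]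

/-- Tuples of the same type over a small set are conjugate over it. -/
theorem IsStronglyHomogeneous.exists_equiv_of_tp_eq [Nonempty M] {μ : Cardinal.{u}}
    (hM : IsStronglyHomogeneous L M μ) (hμ₀ : ℵ₀ ≤ μ) {A : Set M} (hA : #A < μ) {b c : Fin 1 → M}
    (h : tp L A b = tp L A c) : ∃ σ : M ≃[L] M, (∀ a ∈ A, σ a = a) ∧ σ (c 0) = b 0 := by
  have hG := isElementaryGraph_range (L := L) (ι := A ⊕ Fin 1) (x := Sum.elim (↑) c)
    (y := Sum.elim (↑) b) fun φ => (tp_eq_tp_iff.1 h φ).symm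
  obtain ⟨σ, hσ⟩ := hM.exists_equiv hG (mk_range_le.trans_lt (by
    simpa using add_lt_of_lt hμ₀ hA (one_lt_aleph0.trans_le hμ₀)))
  exact ⟨σ, fun a ha => hσ _ ⟨Sum.inl ⟨a, ha⟩, rfl⟩, hσ _ ⟨Sum.inr 0, rfl⟩⟩

end Graphs

/-! ### Calculus of an independence relation -/

section Independence

theorem mk_union_lt {μ : Cardinal.{u}} (hμ : ℵ₀ ≤ μ) {Ω : Type u} {A B : Set Ω} (hA : #A < μ)
    (hB : #B < μ) : #(A ∪ B : Set Ω) < μ :=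
  (mk_union_le A B).trans_lt (add_lt_of_lt hμ hA hB)

theorem mk_lt_of_subset {μ : Cardinal.{u}} {Ω : Type u} {A B : Set Ω} (h : A ⊆ B)
    (hB : #B < μ) : #A < μ :=
  (mk_le_mk_of_subset h).trans_lt hB

theorem mk_lt_of_finite {μ : Cardinal.{u}} (hμ : ℵ₀ ≤ μ) {Ω : Type u} {A : Set Ω}
    (hA : A.Finite) : #A < μ :=
  hA.lt_aleph0.trans_le hμ

variable {L : FirstOrder.Language.{u, u}} {Ω : Type u} [L.Structure Ω] [Nonempty Ω]
  {μ : Cardinal.{u}} {Ind : Set Ω → Set Ω → Set Ω → Prop}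

namespace IsIndependenceRelation

theorem mono_left (h : IsIndependenceRelation L μ Ind) {A A' B C : Set Ω} (hA : #A < μ)
    (hB : #B < μ) (hC : #C < μ) (hA' : A' ⊆ A) (hi : Ind A B C) : Ind A' B C :=
  (h.finiteCharacter A' B C (mk_lt_of_subset hA' hA) hB hC).2 fun A₀ hA₀ hf =>
    (h.finiteCharacter A B C hA hB hC).1 hi A₀ (hA₀.trans hA') hf

theorem mono_right (h : IsIndependenceRelation L μ Ind) {A B C C' : Set Ω} (hA : #A < μ)
    (hB : #B < μ) (hC : #C < μ) (hC' : C' ⊆ C) (hi : Ind A B C) : Ind A B C' :=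
  h.symmetry _ _ _ (mk_lt_of_subset hC' hC) hB hA
    (h.mono_left hC hB hA hC' (h.symmetry _ _ _ hA hB hC hi))

theorem base_mono (h : IsIndependenceRelation L μ Ind) {A B B' C : Set Ω} (hA : #A < μ)
    (hC : #C < μ) (hB : B ⊆ B') (hB' : B' ⊆ C) (hi : Ind A B C) : Ind A B' C :=
  ((h.transitivity A B B' C hA (mk_lt_of_subset (hB.trans hB') hC) (mk_lt_of_subset hB' hC) hC
    hB hB').1 hi).2

theorem union_base_right (h : IsIndependenceRelation L μ Ind) (hμ : ℵ₀ ≤ μ) {A B C : Set Ω}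
    (hA : #A < μ) (hB : #B < μ) (hC : #C < μ) (hi : Ind A B C) : Ind A B (C ∪ B) :=
  h.symmetry _ _ _ (mk_union_lt hμ hC hB) hB hA
    (h.normality _ _ _ hC hA hB (h.symmetry _ _ _ hA hB hC hi))

theorem image_iff (h : IsIndependenceRelation L μ Ind) {A B C : Set Ω} (hA : #A < μ)
    (hB : #B < μ) (hC : #C < μ) (σ : Ω ≃[L] Ω) :
    Ind (σ '' A) (σ '' B) (σ '' C) ↔ Ind A B C := by
  refine ⟨fun hi => ?_, h.invariance A B C hA hB hC σ⟩
  have := h.invariance _ _ _ (mk_image_le.trans_lt hA) (mk_image_le.trans_lt hB)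
    (mk_image_le.trans_lt hC) σ.symm hi
  simpa [Set.image_image] using this

/-- The local character bound `kappaZero` is attained. -/
theorem kappaZero_spec (h : IsIndependenceRelation L μ Ind) (hμ : ℵ₀ ≤ μ) :
    (kappaZero μ Ind).IsRegular ∧ ∀ A B : Set Ω, A.Finite → #B < μ →
      ∃ B₀ : Set Ω, B₀ ⊆ B ∧ #B₀ < kappaZero μ Ind ∧ Ind A B₀ B := by
  refine csInf_mem (s := {κ : Cardinal.{u} | κ.IsRegular ∧ ∀ A B : Set Ω, A.Finite → #B < μ →
    ∃ B₀ : Set Ω, B₀ ⊆ B ∧ #B₀ < κ ∧ Ind A B₀ B}) ?_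
  obtain ⟨l, -, hl⟩ := h.localCharacter
  refine ⟨Order.succ (l + ℵ₀), isRegular_succ (self_le_add_left _ _), fun A B hA hB => ?_⟩
  obtain ⟨B₀, hB₀, hlt, hi⟩ := hl A B (mk_lt_of_finite hμ hA) hB
  refine ⟨B₀, hB₀, Order.lt_succ_of_le (hlt.le.trans ?_), hi⟩
  gcongr
  exact Order.succ_le_of_lt hA.lt_aleph0

/-- A set that is independent from `P` over some elements of `P` becomes free over `P`, that is,
independent from `P` over its intersection with `P`, when elements of `P` are added so that it
contains this base. -/
theorem free_union (h : IsIndependenceRelation L μ Ind) (hμ : ℵ₀ ≤ μ) {A B P C : Set Ω}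
    (hA : #A < μ) (hP : #P < μ) (hC : C ⊆ P) (hB : B ⊆ (A ∪ C) ∩ P) (hi : Ind A B P) :
    Ind (A ∪ C) ((A ∪ C) ∩ P) P := by
  have hb : (A ∪ C) ∩ P ⊆ P := Set.inter_subset_right
  have hbs := mk_lt_of_subset hb hP
  have h1 := h.base_mono hA hP hB hb hi
  refine h.mono_left (mk_union_lt hμ hA hbs) hbs hP ?_ (h.normality _ _ _ hA hP hbs h1)
  exact Set.union_subset_union_right A fun c hc => ⟨Or.inr hc, hC hc⟩

/-- If `A` is free over `P` and `C` is independent from `P` over `A`, then `A ∪ C` is independent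
from `P` over `A ∩ P`. -/
theorem free_union_of_ind (h : IsIndependenceRelation L μ Ind) (hμ : ℵ₀ ≤ μ) {A P C : Set Ω}
    (hA : #A < μ) (hP : #P < μ) (hC : #C < μ) (hi : Ind A (A ∩ P) P) (hCi : Ind C A P) :
    Ind (A ∪ C) (A ∩ P) P := by
  have hb := mk_lt_of_subset (Set.inter_subset_left (s := A) (t := P)) hA
  have hCA := mk_union_lt hμ hC hA
  have h1 : Ind P (A ∩ P) A := h.symmetry _ _ _ hA hb hP hi
  have h2 : Ind P A (C ∪ A) :=
    h.union_base_right hμ hP hA hC (h.symmetry _ _ _ hC hA hP hCi)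
  have h3 := (h.transitivity P (A ∩ P) A (C ∪ A) hP hb hA hCA Set.inter_subset_left
    Set.subset_union_right).2 ⟨h1, h2⟩
  rw [Set.union_comm A C]
  exact h.symmetry _ _ _ hP hb hCA h3

end IsIndependenceRelation

/-- A finite set `A` cannot depend, again and again, on new finite pieces of a growing set: a
strictly dependent chain of length `kappaZero` would contradict local character. The property `R`
of finite character restricts the chains considered. -/
theorem IsIndependenceRelation.exists_no_dependent_extension (h : IsIndependenceRelation L μ Ind)
    (hμ : ℵ₀ ≤ μ) (hκμ : kappaZero μ Ind < μ) {A : Set Ω} (hA : A.Finite) (R : Set Ω → Prop)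
    (hR : ∀ B, (∀ B₀ ⊆ B, B₀.Finite → R B₀) → R B) (hR' : ∀ B B', B' ⊆ B → R B → R B')
    (hR₀ : R ∅) :
    ∃ B, R B ∧ #B ≤ kappaZero μ Ind ∧
      ∀ c : Set Ω, c.Finite → R (B ∪ c) → Ind A B (B ∪ c) := by
  classical
  by_contra! hcon
  set κ := kappaZero μ Ind with hκ
  obtain ⟨hreg, hloc⟩ := h.kappaZero_spec hμ
  rw [← hκ] at hreg hloc
  choose c hcfin hcR hcInd using hcon
  -- The chain adds a dependent finite piece at each step, and takes unions at limits.
  let next : Set Ω → Set Ω := fun B => if hB : R B ∧ #B ≤ κ then B ∪ c B hB.1 hB.2 else B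
  let I := κ.ord.ToType
  have hI : #I = κ := mk_ord_toType κ
  let F : I → Set Ω := wellFounded_lt.fix fun i ih => ⋃ j : Set.Iio i, next (ih j j.2)
  have hF : ∀ i, F i = ⋃ j : Set.Iio i, next (F j) := fun i => wellFounded_lt.fix_eq _ i
  have hle : ∀ B, B ⊆ next B := fun B => by
    by_cases hB : R B ∧ #B ≤ κ
    · simp only [next, dif_pos hB]
      exact Set.subset_union_left
    · simp only [next, dif_neg hB]
      exact subset_rfl
  have hlt : ∀ i j, i < j → next (F i) ⊆ F j := fun i j hij => by
    rw [hF j]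
    exact Set.subset_iUnion (fun k : Set.Iio j => next (F k)) ⟨i, hij⟩
  have hmono : ∀ i j, i ≤ j → next (F i) ⊆ next (F j) := fun i j hij => by
    rcases hij.eq_or_lt with rfl | hij
    · exact subset_rfl
    · exact (hlt i j hij).trans (hle _)
  have hcard : ∀ B : Set Ω, #B ≤ κ → #(next B) ≤ κ := fun B hBκ => by
    by_cases hB : R B ∧ #B ≤ κ
    · simp only [next, dif_pos hB]
      exact (mk_union_le _ _).trans (add_le_of_le hreg.aleph0_le hBκ
        ((hcfin B hB.1 hB.2).lt_aleph0.le.trans hreg.aleph0_le))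
    · simpa only [next, dif_neg hB] using hBκ
  have hunion : ∀ s : Set I, (∀ i ∈ s, #(F i) ≤ κ) → #(⋃ i : s, next (F i)) ≤ κ := fun s hs => by
    refine (mk_iUnion_le _).trans ((mul_le_mul' ((mk_set_le s).trans_eq hI)
      (ciSup_le' fun i : s => hcard _ (hs i i.2))).trans (mul_eq_self hreg.aleph0_le).le)
  have key : ∀ i, R (F i) ∧ #(F i) ≤ κ := by
    intro i
    induction i using WellFoundedLT.induction with
    | _ i ih =>
    refine ⟨hR _ fun B₀ hB₀ hfin => ?_, ?_⟩
    · rcases B₀.eq_empty_or_nonempty with rfl | ⟨b, hb⟩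
      · exact hR₀
      · rw [hF i] at hB₀
        have : Nonempty (Set.Iio i) := by
          obtain ⟨j, -⟩ := Set.mem_iUnion.1 (hB₀ hb)
          exact ⟨j⟩
        obtain ⟨_, ⟨j, rfl⟩, hj⟩ := DirectedOn.exists_mem_subset_of_finite_of_subset_sUnion
          (c := Set.range fun j : Set.Iio i => next (F j)) (Set.range_nonempty _) (by
            rintro _ ⟨j, rfl⟩ _ ⟨k, rfl⟩
            rcases le_total (j : I) k with hjk | hjk
            · exact ⟨_, ⟨k, rfl⟩, hmono _ _ hjk, subset_rfl⟩
            · exact ⟨_, ⟨j, rfl⟩, subset_rfl, hmono _ _ hjk⟩) hfin hB₀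
        refine hR' _ _ hj ?_
        have hj' := ih j j.2
        simp only [next, dif_pos hj']
        exact hcR _ hj'.1 hj'.2
    · rw [hF i]
      exact hunion (Set.Iio i) fun j hj => (ih j hj).2
  let B : Set Ω := ⋃ i : (Set.univ : Set I), next (F i)
  have hBκ : #B ≤ κ := hunion Set.univ fun i _ => (key i).2
  obtain ⟨B₀, hB₀, hB₀κ, hInd⟩ := hloc A B hA (hBκ.trans_lt hκμ)
  choose f hf using fun b : B₀ => Set.mem_iUnion.1 (hB₀ b.2)
  -- By regularity, the small subset `B₀` of the union is contained in one member of the chain.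
  have hbdd : ¬ IsCofinal (Set.range fun b => (f b : I)) := fun hcof => by
    have := Order.cof_le hcof
    rw [Ordinal.cof_toType, hreg.cof_ord] at this
    exact (this.trans mk_range_le).not_gt hB₀κ
  simp only [IsCofinal, Set.mem_range, not_forall, not_exists, exists_exists_eq_and] at hbdd
  obtain ⟨i, hi⟩ := hbdd
  have hB₀i : B₀ ⊆ F i := fun b hb => hlt _ _ (not_le.1 (hi ⟨b, hb⟩)) (hf ⟨b, hb⟩)
  have hnext : next (F i) ⊆ B :=
    Set.subset_iUnion (fun i : (Set.univ : Set I) => next (F i)) ⟨i, trivial⟩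
  have hAμ := mk_lt_of_finite hμ hA
  have h1 : Ind A (F i) B := h.base_mono hAμ (hBκ.trans_lt hκμ) hB₀i ((hle _).trans hnext) hInd
  have h2 := h.mono_right hAμ ((key i).2.trans_lt hκμ) (hBκ.trans_lt hκμ) hnext h1
  simp only [next, dif_pos (key i)] at h2
  exact hcInd _ _ _ h2

end Independence

/-! ### Back and forth between lovely pairs -/

section BackAndForth

variable {L : FirstOrder.Language.{u, u}} {Ω : Type u} [L.Structure Ω]

theorem isElementaryGraph_equiv (σ : Ω ≃[L] Ω) : IsElementaryGraph L {g : Ω × Ω | σ g.1 = g.2} := by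
  intro m φ g hg
  rw [show Prod.snd ∘ g = σ ∘ Prod.fst ∘ g from funext fun i => (hg i).symm]
  exact (StrongHomClass.realize_formula σ φ).symm

variable {μ κ : Cardinal.{u}} {Ind : Set Ω → Set Ω → Set Ω → Prop}

variable (L μ κ Ind) in
/-- Loveliness of a pair of subsets `P ⊆ M` of the monster model, expressed with automorphisms of
the monster model instead of types. -/
structure IsLovelySet (M P : Set Ω) : Prop where
  small : #M < μ
  subset : P ⊆ M
  density : ∀ A ⊆ M, #A < κ → ∀ x : Ω, Ind {x} (A ∩ P) A →
    ∃ τ : Ω ≃[L] Ω, (∀ a ∈ A, τ a = a) ∧ τ x ∈ P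
  extension : ∀ A ⊆ M, #A < κ → ∀ x : Ω,
    ∃ τ : Ω ≃[L] Ω, (∀ a ∈ A, τ a = a) ∧ τ x ∈ M ∧ Ind {τ x} A P

theorem IsLovelySet.small_pred {M P : Set Ω} (h : IsLovelySet L μ κ Ind M P) : #P < μ :=
  mk_lt_of_subset h.subset h.small

theorem IsLovelyPair.isLovelySet [Nonempty Ω] (hhom : IsStronglyHomogeneous L Ω μ)
    (hμ : ℵ₀ ≤ μ) (hκμ : κ < μ) {M : L.ElementarySubstructure Ω} {P : Set M}
    (h : IsLovelyPair L μ κ Ind M P) :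
    IsLovelySet L μ κ Ind (M : Set Ω) (Subtype.val '' P) := by
  have hrange : ∀ b : Fin 1 → Ω, Set.range b = {b 0} := fun b => Set.range_unique
  refine ⟨h.small, ?_, fun A hA hAκ x hx => ?_, fun A hA hAκ x => ?_⟩
  · rintro _ ⟨a, -, rfl⟩
    exact a.2
  · obtain ⟨b, hb, htp⟩ := h.density A hA hAκ (tp L A fun _ => x)
      ⟨fun _ => x, rfl, by rwa [hrange]⟩
    obtain ⟨τ, hτ, hτx⟩ := hhom.exists_equiv_of_tp_eq hμ (hAκ.trans hκμ) htp
    exact ⟨τ, hτ, by rwa [hτx]⟩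
  · obtain ⟨b, hb, htp, hInd⟩ := h.extension A hA hAκ (tp L A fun _ => x)
    obtain ⟨τ, hτ, hτx⟩ := hhom.exists_equiv_of_tp_eq hμ (hAκ.trans hκμ) htp
    exact ⟨τ, hτ, by rwa [hτx], by rwa [hτx, ← hrange]⟩

variable (κ Ind) in
/-- `σ` restricts to a partial isomorphism with very small domain `A`, from `(M, P)` to `(N, Q)`,
such that `A` is free in `(M, P)` and its image is free in `(N, Q)`. -/
structure IsFreeMap (M P N Q A : Set Ω) (σ : Ω ≃[L] Ω) : Prop where
  subset : A ⊆ M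
  image_subset : σ '' A ⊆ N
  card : #A < κ
  mem_iff : ∀ a ∈ A, a ∈ P ↔ σ a ∈ Q
  free : Ind A (A ∩ P) P
  free_image : Ind (σ '' A) (σ '' A ∩ Q) Q

theorem image_inter_eq {A P Q : Set Ω} {σ : Ω ≃[L] Ω} (h : ∀ a ∈ A, a ∈ P ↔ σ a ∈ Q) :
    σ '' (A ∩ P) = σ '' A ∩ Q := by
  ext b
  constructor
  · rintro ⟨a, ⟨ha, haP⟩, rfl⟩
    exact ⟨⟨a, ha, rfl⟩, (h a ha).1 haP⟩
  · rintro ⟨⟨a, ha, rfl⟩, hb⟩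
    exact ⟨a, ⟨ha, (h a ha).2 hb⟩, rfl⟩

namespace IsFreeMap

variable {M P N Q A : Set Ω} {σ : Ω ≃[L] Ω}

theorem symm (h : IsFreeMap κ Ind M P N Q A σ) : IsFreeMap κ Ind N Q M P (σ '' A) σ.symm := by
  have hA : σ.symm '' (σ '' A) = A := by simp [Set.image_image]
  refine ⟨h.image_subset, hA.subset.trans h.subset, mk_image_le.trans_lt h.card, ?_,
    h.free_image, by rw [hA]; exact h.free⟩
  rintro _ ⟨a, ha, rfl⟩
  rw [Language.Equiv.symm_apply_apply]
  exact (h.mem_iff a ha).symm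

variable [Nonempty Ω]

/-- A free map stays free when its domain is enlarged by elements of `P` with images in `Q`. -/
theorem union_of_subset (hInd : IsIndependenceRelation L μ Ind) (hκ : ℵ₀ ≤ κ) (hκμ : κ < μ)
    (hM : IsLovelySet L μ κ Ind M P) (hN : IsLovelySet L μ κ Ind N Q)
    (h : IsFreeMap κ Ind M P N Q A σ) {C : Set Ω} (hC : C ⊆ P) (hCκ : #C < κ) {σ' : Ω ≃[L] Ω}
    (hσ' : ∀ a ∈ A, σ' a = σ a) (hCQ : σ' '' C ⊆ Q) : IsFreeMap κ Ind M P N Q (A ∪ C) σ' := by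
  have hμ := hκ.trans hκμ.le
  have himg : σ' '' (A ∪ C) = σ '' A ∪ σ' '' C := by
    rw [Set.image_union, Set.image_congr hσ']
  refine ⟨Set.union_subset h.subset (hC.trans hM.subset), ?_, mk_union_lt hκ h.card hCκ, ?_,
    hInd.free_union hμ (h.card.trans hκμ) hM.small_pred hC
      (Set.inter_subset_inter_left P Set.subset_union_left) h.free, ?_⟩
  · rw [himg]
    exact Set.union_subset h.image_subset (hCQ.trans hN.subset)
  · rintro a (ha | ha)
    · rw [hσ' a ha]
      exact h.mem_iff a ha
    · exact iff_of_true (hC ha) (hCQ ⟨a, ha, rfl⟩)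
  · rw [himg]
    exact hInd.free_union hμ (mk_image_le.trans_lt (h.card.trans hκμ)) hN.small_pred hCQ
      (Set.inter_subset_inter_left Q Set.subset_union_left) h.free_image

/-- Density provides an image in `Q` for an element of `P`. -/
theorem exists_map_pred (hInd : IsIndependenceRelation L μ Ind) (hκ : ℵ₀ ≤ κ) (hκμ : κ < μ)
    (hM : IsLovelySet L μ κ Ind M P) (hN : IsLovelySet L μ κ Ind N Q)
    (h : IsFreeMap κ Ind M P N Q A σ) {c : Ω} (hc : c ∈ P) :
    ∃ σ' : Ω ≃[L] Ω, (∀ a ∈ A, σ' a = σ a) ∧ σ' c ∈ Q := by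
  have hμ := hκ.trans hκμ.le
  have hA := h.card.trans hκμ
  have hAP := mk_lt_of_subset (Set.inter_subset_left (s := A) (t := P)) hA
  have hcμ := mk_lt_of_finite hμ (Set.finite_singleton c)
  have h1 : Ind {c} (A ∩ P) A := hInd.symmetry _ _ _ hA hAP hcμ
    (hInd.mono_right hA hAP hM.small_pred (Set.singleton_subset_iff.2 hc) h.free)
  have h2 := (hInd.image_iff hcμ hAP hA σ).2 h1
  rw [Set.image_singleton, image_inter_eq h.mem_iff] at h2
  obtain ⟨τ, hτ, hτQ⟩ := hN.density _ h.image_subset (mk_image_le.trans_lt h.card) _ h2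
  exact ⟨τ.comp σ, fun a ha => hτ _ ⟨a, ha, rfl⟩, hτQ⟩

/-- A free map extends to very small sets of new elements of `P`, by repeated use of density. -/
theorem exists_union_of_subset (hInd : IsIndependenceRelation L μ Ind)
    (hhom : IsStronglyHomogeneous L Ω μ) (hκ : ℵ₀ ≤ κ) (hκμ : κ < μ)
    (hM : IsLovelySet L μ κ Ind M P) (hN : IsLovelySet L μ κ Ind N Q)
    (h : IsFreeMap κ Ind M P N Q A σ) {C : Set Ω} (hC : C ⊆ P) (hCκ : #C < κ) :
    ∃ σ' : Ω ≃[L] Ω, (∀ a ∈ A, σ' a = σ a) ∧ IsFreeMap κ Ind M P N Q (A ∪ C) σ' := by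
  let G₀ : Set (Ω × Ω) := (fun a => (a, σ a)) '' A
  have hG₀ : IsElementaryGraph L G₀ := (isElementaryGraph_equiv σ).mono (by
    rintro _ ⟨a, -, rfl⟩
    rfl)
  have hcard : ∀ G : Set (Ω × Ω), G ⊆ G₀ ∪ C ×ˢ Q → IsElementaryGraph L G → #G < μ := by
    intro G hGsub hG
    refine (hG.mk_le (C := A ∪ C) fun g hg => ?_).trans_lt
      ((mk_union_lt hκ h.card hCκ).trans hκμ)
    rcases hGsub hg with ⟨a, ha, rfl⟩ | hg
    · exact Or.inl ha
    · exact Or.inr hg.1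
  obtain ⟨G, hG₀G, hGsub, hG, hGC⟩ := hG₀.exists_extension C Q fun G hG₀G hGsub hG c hc => by
    obtain ⟨σ₁, hσ₁⟩ := hhom.exists_equiv hG (hcard G hGsub hG)
    have h₁ : IsFreeMap κ Ind M P N Q (A ∪ Prod.fst '' (G ∩ C ×ˢ Q)) σ₁ := by
      have hsub : Prod.fst '' (G ∩ C ×ˢ Q) ⊆ C := by
        rintro _ ⟨g, hg, rfl⟩
        exact hg.2.1
      refine h.union_of_subset hInd hκ hκμ hM hN (hsub.trans hC) (mk_lt_of_subset hsub hCκ)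
        (fun a ha => hσ₁ _ (hG₀G ⟨a, ha, rfl⟩)) ?_
      rintro _ ⟨_, ⟨g, hg, rfl⟩, rfl⟩
      rw [hσ₁ g hg.1]
      exact hg.2.2
    obtain ⟨σ₂, hσ₂, hσ₂c⟩ := h₁.exists_map_pred hInd hκ hκμ hM hN (hC hc)
    refine ⟨σ₂ c, hσ₂c, (isElementaryGraph_equiv σ₂).mono ?_⟩
    rintro g (rfl | hg)
    · rfl
    · refine (hσ₂ _ ?_).trans (hσ₁ g hg)
      rcases hGsub hg with ⟨a, ha, rfl⟩ | hg'
      · exact Or.inl ha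
      · exact Or.inr ⟨g, ⟨hg, hg'⟩, rfl⟩
  obtain ⟨σ', hσ'⟩ := hhom.exists_equiv hG (hcard G hGsub hG)
  have hA : ∀ a ∈ A, σ' a = σ a := fun a ha => hσ' _ (hG₀G ⟨a, ha, rfl⟩)
  refine ⟨σ', hA, h.union_of_subset hInd hκ hκμ hM hN hC hCκ hA ?_⟩
  rintro _ ⟨c, hc, rfl⟩
  obtain ⟨d, hd, hcd⟩ := hGC c hc
  rwa [show σ' c = d from hσ' _ hcd]

/-- The `forth` step: first the dependence of `c` on `P` is absorbed into the domain by density,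
then the extension property provides an image for `c`. -/
theorem exists_forth (hInd : IsIndependenceRelation L μ Ind)
    (hhom : IsStronglyHomogeneous L Ω μ) (hκ : ℵ₀ ≤ κ) (hκ₀ : kappaZero μ Ind < κ) (hκμ : κ < μ)
    (hM : IsLovelySet L μ κ Ind M P) (hN : IsLovelySet L μ κ Ind N Q)
    (h : IsFreeMap κ Ind M P N Q A σ) {c : Ω} (hc : c ∈ M) :
    ∃ (A' : Set Ω) (σ' : Ω ≃[L] Ω), A ⊆ A' ∧ c ∈ A' ∧ (∀ a ∈ A, σ' a = σ a) ∧
      IsFreeMap κ Ind M P N Q A' σ' := by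
  have hμ := hκ.trans hκμ.le
  have hcκ : #({c} : Set Ω) < κ := mk_lt_of_finite hκ (Set.finite_singleton c)
  have hcμ := hcκ.trans hκμ
  by_cases hcP : c ∈ P
  · obtain ⟨σ', hσ', h'⟩ := h.exists_union_of_subset hInd hhom hκ hκμ hM hN
      (Set.singleton_subset_iff.2 hcP) hcκ
    exact ⟨A ∪ {c}, σ', Set.subset_union_left, Or.inr rfl, hσ', h'⟩
  have hAP := mk_union_lt hμ (h.card.trans hκμ) hM.small_pred
  obtain ⟨B, hBsub, hBκ, hB⟩ := (hInd.kappaZero_spec hμ).2 {c} (A ∪ P) (Set.finite_singleton c) hAP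
  obtain ⟨σ₁, hσ₁, h₁⟩ := h.exists_union_of_subset hInd hhom hκ hκμ hM hN
    (Set.inter_subset_right (s := B) (t := P))
    ((mk_lt_of_subset Set.inter_subset_left hBκ).trans hκ₀)
  set A₁ := A ∪ B ∩ P
  have hA₁ := h₁.card.trans hκμ
  have hσA₁ : #(σ₁ '' A₁) < μ := mk_image_le.trans_lt hA₁
  have hcA₁ : Ind {c} A₁ P := by
    refine hInd.mono_right hcμ hA₁ hAP Set.subset_union_right
      (hInd.base_mono hcμ hAP (fun b hb => ?_) ?_ hB)
    · rcases hBsub hb with hb' | hb'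
      · exact Or.inl hb'
      · exact Or.inr ⟨hb, hb'⟩
    · exact Set.union_subset_union_right A Set.inter_subset_right
  obtain ⟨τ, hτ, hτN, hτInd⟩ := hN.extension _ h₁.image_subset (mk_image_le.trans_lt h₁.card) (σ₁ c)
  let σ₂ : Ω ≃[L] Ω := τ.comp σ₁
  have hσ₂ : ∀ a ∈ A₁, σ₂ a = σ₁ a := fun a ha => hτ _ ⟨a, ha, rfl⟩
  have himg : σ₂ '' A₁ = σ₁ '' A₁ := Set.image_congr hσ₂
  have hcd : σ₂ c = τ (σ₁ c) := rfl
  have hdμ : #({σ₂ c} : Set Ω) < μ := mk_lt_of_finite hμ (Set.finite_singleton _)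
  have hA₁c : (A₁ ∪ {c}) ∩ P = A₁ ∩ P := by
    ext a
    simp only [Set.mem_inter_iff, Set.mem_union, Set.mem_singleton_iff]
    constructor
    · rintro ⟨ha | rfl, haP⟩
      · exact ⟨ha, haP⟩
      · exact absurd haP hcP
    · rintro ⟨ha, haP⟩
      exact ⟨Or.inl ha, haP⟩
  have hb₁ := mk_lt_of_subset (Set.inter_subset_left (s := A₁) (t := P)) hA₁
  have hb₂ := mk_lt_of_subset (Set.inter_subset_left (s := σ₁ '' A₁) (t := Q)) hσA₁
  -- If the image of `c` were in `Q`, it would be independent from itself over `σ₁ '' A₁ ∩ Q`. Then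
  -- density applies to the type of `c` over `A₁ ∪ {c}`, and shows that `c` is in `P`.
  have hdQ : σ₂ c ∉ Q := by
    intro hd
    have hdQ' : {σ₂ c} ⊆ Q := Set.singleton_subset_iff.2 hd
    have e1 : Ind {σ₂ c} (σ₁ '' A₁ ∩ Q) (σ₁ '' A₁) := hInd.symmetry _ _ _ hσA₁ hb₂ hdμ
      (hInd.mono_right hσA₁ hb₂ hN.small_pred hdQ' h₁.free_image)
    have e2 : Ind {σ₂ c} (σ₁ '' A₁) ({σ₂ c} ∪ σ₁ '' A₁) :=
      hInd.union_base_right hμ hdμ hσA₁ hdμ (hInd.mono_right hdμ hσA₁ hN.small_pred hdQ' hτInd)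
    have e3 : Ind {σ₂ c} (σ₁ '' A₁ ∩ Q) ({σ₂ c} ∪ σ₁ '' A₁) :=
      (hInd.transitivity _ _ _ _ hdμ hb₂ hσA₁ (mk_union_lt hμ hdμ hσA₁) Set.inter_subset_left
        Set.subset_union_right).2 ⟨e1, e2⟩
    rw [← image_inter_eq h₁.mem_iff, ← Set.image_congr fun a (ha : a ∈ A₁ ∩ P) => hσ₂ a ha.1,
      ← himg, ← Set.image_singleton, ← Set.image_union,
      hInd.image_iff hcμ hb₁ (mk_union_lt hμ hcμ hA₁)] at e3
    obtain ⟨ρ, hρ, hρc⟩ := hM.density (A₁ ∪ {c})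
      (Set.union_subset h₁.subset (Set.singleton_subset_iff.2 hc)) (mk_union_lt hκ h₁.card hcκ) c
      (by rwa [hA₁c, Set.union_comm])
    rw [hρ c (Or.inr rfl)] at hρc
    exact hcP hρc
  have himg' : σ₂ '' (A₁ ∪ {c}) = σ₁ '' A₁ ∪ {σ₂ c} := by
    rw [Set.image_union, himg, Set.image_singleton]
  have hdA₁ : (σ₁ '' A₁ ∪ {σ₂ c}) ∩ Q = σ₁ '' A₁ ∩ Q := by
    ext a
    simp only [Set.mem_inter_iff, Set.mem_union, Set.mem_singleton_iff]
    constructor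
    · rintro ⟨ha | rfl, haP⟩
      · exact ⟨ha, haP⟩
      · exact absurd haP hdQ
    · rintro ⟨ha, haP⟩
      exact ⟨Or.inl ha, haP⟩
  refine ⟨A₁ ∪ {c}, σ₂, Set.subset_union_left.trans Set.subset_union_left, Or.inr rfl,
    fun a ha => (hσ₂ a (Or.inl ha)).trans (hσ₁ a ha),
    Set.union_subset h₁.subset (Set.singleton_subset_iff.2 hc), ?_, mk_union_lt hκ h₁.card hcκ,
    ?_, ?_, ?_⟩
  · rw [himg']
    exact Set.union_subset h₁.image_subset (Set.singleton_subset_iff.2 hτN)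
  · rintro a (ha | rfl)
    · rw [hσ₂ a ha]
      exact h₁.mem_iff a ha
    · exact iff_of_false hcP hdQ
  · rw [hA₁c]
    exact hInd.free_union_of_ind hμ hA₁ hM.small_pred hcμ h₁.free hcA₁
  · rw [himg', hdA₁]
    exact hInd.free_union_of_ind hμ hσA₁ hN.small_pred hdμ h₁.free_image hτInd

/-- The `back` step: `exists_forth` for the inverse map. -/
theorem exists_back (hInd : IsIndependenceRelation L μ Ind)
    (hhom : IsStronglyHomogeneous L Ω μ) (hκ : ℵ₀ ≤ κ) (hκ₀ : kappaZero μ Ind < κ) (hκμ : κ < μ)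
    (hM : IsLovelySet L μ κ Ind M P) (hN : IsLovelySet L μ κ Ind N Q)
    (h : IsFreeMap κ Ind M P N Q A σ) {d : Ω} (hd : d ∈ N) :
    ∃ (A' : Set Ω) (σ' : Ω ≃[L] Ω), A ⊆ A' ∧ d ∈ σ' '' A' ∧ (∀ a ∈ A, σ' a = σ a) ∧
      IsFreeMap κ Ind M P N Q A' σ' := by
  obtain ⟨B, τ, hB, hdB, hτ, h'⟩ := h.symm.exists_forth hInd hhom hκ hκ₀ hκμ hN hM hd
  have hA : ∀ a ∈ A, τ (σ a) = a := fun a ha => by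
    rw [hτ _ ⟨a, ha, rfl⟩, Language.Equiv.symm_apply_apply]
  refine ⟨τ '' B, τ.symm, fun a ha => ⟨σ a, hB ⟨a, ha, rfl⟩, hA a ha⟩,
    ⟨τ d, ⟨d, hdB, rfl⟩, Language.Equiv.symm_apply_apply _ _⟩, fun a ha => ?_, h'.symm⟩
  rw [← Language.Equiv.symm_apply_apply τ (σ a), hA a ha]

end IsFreeMap

end BackAndForth

/-! ### The language of pairs -/

section PairSemantics

variable {L : FirstOrder.Language.{u, u}} {Ω : Type u} [L.Structure Ω]
  {M : L.ElementarySubstructure Ω} {P : Set M}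

/-- The inclusion of a pair `(M, P)` into the monster model that contains `M`. -/
def pairVal (x : PairOf P) : Ω := M.subtype x

theorem pairVal_injective : Function.Injective (pairVal : PairOf P → Ω) :=
  Subtype.val_injective

theorem pairVal_mem (x : PairOf P) : pairVal x ∈ (M : Set Ω) :=
  Subtype.property (p := fun y : Ω => y ∈ M) x

theorem exists_pairVal {x : Ω} (hx : x ∈ (M : Set Ω)) : ∃ y : PairOf P, pairVal y = x :=
  ⟨(⟨x, hx⟩ : M), rfl⟩

theorem realize_onFormula_iff {α : Type*} (φ : L.Formula α) (v : α → PairOf P) :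
    ((LHom.sumInl : L →ᴸ L2 L).onFormula φ).Realize v ↔ φ.Realize (pairVal ∘ v) := by
  rw [LHom.realize_onFormula]
  exact (M.subtype.map_formula φ v).symm

theorem realize_onBoundedFormula_iff {α : Type*} {n : ℕ} (φ : L.BoundedFormula α n)
    (v : α → PairOf P) (xs : Fin n → PairOf P) :
    ((LHom.sumInl : L →ᴸ L2 L).onBoundedFormula φ).Realize v xs ↔
      φ.Realize (pairVal ∘ v) (pairVal ∘ xs) := by
  rw [LHom.realize_onBoundedFormula]
  exact (M.subtype.map_boundedFormula φ v xs).symm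

theorem relMap_predSymbol_iff (x : Fin 1 → PairOf P) :
    Structure.RelMap (predSymbol L) x ↔ pairVal (x 0) ∈ Subtype.val '' P :=
  ⟨fun h => ⟨_, h, rfl⟩, fun ⟨y, hy, h⟩ => by
    have hyx : y = x 0 := Subtype.val_injective h
    change (x 0 : M) ∈ P
    rwa [← hyx]⟩

theorem realize_specialFormula_iff {n m : ℕ} (φ : L.Formula (Fin n ⊕ Fin m))
    (a : Fin n → PairOf P) :
    (specialFormula (BoundedFormula.relabel id φ : L.BoundedFormula (Fin n) (m + 0))).Realize a ↔
      ∃ d : Fin m → Ω, (∀ i, d i ∈ Subtype.val '' P) ∧ φ.Realize (Sum.elim (pairVal ∘ a) d) := by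
  have h : ∀ d : Fin m → PairOf P,
      (BoundedFormula.relabel id φ : L.BoundedFormula (Fin n) (m + 0)).Realize (pairVal ∘ a)
        (pairVal ∘ d) ↔
          φ.Realize (Sum.elim (pairVal ∘ a) (pairVal ∘ d)) := by
    intro d
    rw [BoundedFormula.realize_relabel]
    exact iff_of_eq (congrArg₂ _ rfl (Subsingleton.elim _ _))
  rw [specialFormula, BoundedFormula.realize_exs]
  simp only [BoundedFormula.realize_inf, BoundedFormula.realize_iInf,
    realize_onBoundedFormula_iff]
  constructor
  · rintro ⟨d, hd, hφ⟩
    refine ⟨pairVal ∘ d, fun i => ?_, (h d).1 hφ⟩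
    exact (relMap_predSymbol_iff fun _ => d i).1 (BoundedFormula.realize_rel₁.1 (hd i))
  · rintro ⟨d, hd, hφ⟩
    choose d' hd' hdd' using hd
    obtain rfl : pairVal ∘ (show Fin m → PairOf P from d') = d := funext hdd'
    exact ⟨d', fun i => (relMap_predSymbol_iff _).2 ⟨_, hd' i, rfl⟩, (h d').2 hφ⟩

end PairSemantics

/-! ### Invariance of formulas under free maps -/

section Transfer

variable {L : FirstOrder.Language.{u, u}} {Ω : Type u} [L.Structure Ω]
  {M N : L.ElementarySubstructure Ω} {P : Set M} {Q : Set N}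

theorem map_realize_term {α : Type*} (t : (L2 L).Term α) (σ : Ω ≃[L] Ω) {v : α → PairOf P}
    {w : α → PairOf Q} (h : ∀ i, σ (pairVal (v i)) = pairVal (w i)) :
    σ (pairVal (t.realize v)) = pairVal (t.realize w) := by
  induction t with
  | var i => exact h i
  | @func l f ts ih =>
    rcases f with f | f
    · have hM : pairVal (Term.realize v (Term.func (Sum.inl f) ts)) =
          Structure.funMap f fun i => pairVal (Term.realize v (ts i)) :=
        M.subtype.map_fun f fun i => Term.realize (M := PairOf P) v (ts i)
      have hN : pairVal (Term.realize w (Term.func (Sum.inl f) ts)) =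
          Structure.funMap f fun i => pairVal (Term.realize w (ts i)) :=
        N.subtype.map_fun f fun i => Term.realize (M := PairOf Q) w (ts i)
      rw [hM, hN, HomClass.map_fun σ]
      exact congrArg _ (funext ih)
    · exact Empty.elim f

variable [Nonempty Ω] {μ κ : Cardinal.{u}} {Ind : Set Ω → Set Ω → Set Ω → Prop}

/-- Free maps between lovely pairs preserve all formulas of the language of pairs. -/
theorem IsFreeMap.realize_iff (hInd : IsIndependenceRelation L μ Ind)
    (hhom : IsStronglyHomogeneous L Ω μ) (hκ : ℵ₀ ≤ κ) (hκ₀ : kappaZero μ Ind < κ) (hκμ : κ < μ)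
    (hM : IsLovelySet L μ κ Ind (M : Set Ω) (Subtype.val '' P))
    (hN : IsLovelySet L μ κ Ind (N : Set Ω) (Subtype.val '' Q)) {α : Type*} {n : ℕ}
    (φ : (L2 L).BoundedFormula α n) {A : Set Ω} {σ : Ω ≃[L] Ω}
    (h : IsFreeMap κ Ind (M : Set Ω) (Subtype.val '' P) (N : Set Ω) (Subtype.val '' Q) A σ)
    {v : α → PairOf P} {xs : Fin n → PairOf P} {w : α → PairOf Q} {ys : Fin n → PairOf Q}
    (hv : ∀ i, pairVal (v i) ∈ A) (hxs : ∀ i, pairVal (xs i) ∈ A)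
    (hvw : ∀ i, σ (pairVal (v i)) = pairVal (w i))
    (hxy : ∀ i, σ (pairVal (xs i)) = pairVal (ys i)) :
    φ.Realize v xs ↔ φ.Realize w ys := by
  have elim : ∀ {n : ℕ} {σ : Ω ≃[L] Ω} {xs : Fin n → PairOf P} {ys : Fin n → PairOf Q},
      (∀ i, σ (pairVal (v i)) = pairVal (w i)) → (∀ i, σ (pairVal (xs i)) = pairVal (ys i)) →
      ∀ i, σ (pairVal (Sum.elim v xs i)) = pairVal (Sum.elim w ys i) := by
    rintro n σ xs ys h1 h2 (i | i)
    · exact h1 i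
    · exact h2 i
  induction φ generalizing A σ with
  | falsum => rfl
  | equal t₁ t₂ =>
    have h1 := map_realize_term t₁ σ (elim hvw hxy)
    have h2 := map_realize_term t₂ σ (elim hvw hxy)
    rw [BoundedFormula.Realize, BoundedFormula.Realize, ← pairVal_injective.eq_iff,
      ← pairVal_injective.eq_iff (b := Term.realize (Sum.elim w ys) t₂), ← h1, ← h2]
    exact σ.injective.eq_iff.symm
  | @rel _ l R ts =>
    rcases R with R | R
    · have hM' := M.subtype.map_rel R fun i =>
        Term.realize (M := PairOf P) (Sum.elim v xs) (ts i)
      have hN' := N.subtype.map_rel R fun i =>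
        Term.realize (M := PairOf Q) (Sum.elim w ys) (ts i)
      refine hM'.symm.trans (Iff.trans ?_ hN')
      rw [← StrongHomClass.map_rel σ]
      exact iff_of_eq (congrArg _ (funext fun i => map_realize_term (ts i) σ (elim hvw hxy)))
    · cases R
      -- The value of a term need not belong to `A`, but it is moved in the only possible way by
      -- an extension of the map whose domain contains it.
      obtain ⟨A', σ', hA', hc, hσ', h'⟩ := h.exists_forth hInd hhom hκ hκ₀ hκμ hM hN
        (pairVal_mem (Term.realize (Sum.elim v xs) (ts 0)))
      have hval := map_realize_term (ts 0) σ' (elim (fun i => (hσ' _ (hv i)).trans (hvw i))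
        fun i => (hσ' _ (hxs i)).trans (hxy i))
      have hiff := h'.mem_iff _ hc
      rw [hval] at hiff
      exact (relMap_predSymbol_iff fun i => Term.realize (Sum.elim v xs) (ts i)).trans
        (hiff.trans (relMap_predSymbol_iff fun i => Term.realize (Sum.elim w ys) (ts i)).symm)
  | imp φ ψ ihφ ihψ =>
    rw [BoundedFormula.realize_imp, BoundedFormula.realize_imp]
    exact imp_congr (ihφ h hv hxs hvw hxy) (ihψ h hv hxs hvw hxy)
  | @all k φ ih =>
    rw [BoundedFormula.realize_all, BoundedFormula.realize_all]
    have ext : ∀ {A' : Set Ω} {σ' : Ω ≃[L] Ω}, A ⊆ A' → (∀ a ∈ A, σ' a = σ a) →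
        IsFreeMap κ Ind (M : Set Ω) (Subtype.val '' P) (N : Set Ω) (Subtype.val '' Q) A' σ' →
        ∀ (x : PairOf P) (y : PairOf Q), pairVal x ∈ A' → σ' (pairVal x) = pairVal y →
        (φ.Realize v (Fin.snoc xs x) ↔ φ.Realize w (Fin.snoc ys y)) := by
      intro A' σ' hA' hσ' h' x y hx hxy'
      refine ih h' (fun i => hA' (hv i)) (fun i => ?_) (fun i => (hσ' _ (hv i)).trans (hvw i))
        fun i => ?_
      · refine Fin.lastCases ?_ (fun j => ?_) i
        · simpa using hx
        · simpa using hA' (hxs j)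
      · refine Fin.lastCases ?_ (fun j => ?_) i
        · simpa using hxy'
        · simpa using (hσ' _ (hxs j)).trans (hxy j)
    constructor
    · intro hall y
      obtain ⟨A', σ', hA', ⟨x, hx, hxy'⟩, hσ', h'⟩ :=
        h.exists_back hInd hhom hκ hκ₀ hκμ hM hN (pairVal_mem y)
      obtain ⟨x, rfl⟩ := exists_pairVal (P := P) (h'.subset hx)
      exact (ext hA' hσ' h' x y hx hxy').1 (hall x)
    · intro hall x
      obtain ⟨A', σ', hA', hx, hσ', h'⟩ :=
        h.exists_forth hInd hhom hκ hκ₀ hκμ hM hN (pairVal_mem x)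
      obtain ⟨y, hy⟩ := exists_pairVal (P := Q) (h'.image_subset ⟨_, hx, rfl⟩)
      exact (ext hA' hσ' h' x y hx hy.symm).2 (hall y)

end Transfer

/-! ### Special types and free maps -/

section Reflection

variable {L : FirstOrder.Language.{u, u}} {Ω : Type u} [L.Structure Ω]

variable (L) in
/-- The set `B` is reflected in `P` over `a`: every formula over `a` that holds for a finite tuple
from `B` holds for some tuple from `P`. -/
def IsReflected {n : ℕ} (a : Fin n → Ω) (P B : Set Ω) : Prop :=
  ∀ (m : ℕ) (φ : L.Formula (Fin n ⊕ Fin m)) (c : Fin m → Ω), (∀ i, c i ∈ B) →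
    φ.Realize (Sum.elim a c) → ∃ d : Fin m → Ω, (∀ i, d i ∈ P) ∧ φ.Realize (Sum.elim a d)

theorem IsReflected.mono {n : ℕ} {a : Fin n → Ω} {P B B' : Set Ω} (h : IsReflected L a P B)
    (hB : B' ⊆ B) : IsReflected L a P B' :=
  fun m φ c hc => h m φ c fun i => hB (hc i)

theorem isReflected_of_finite {n : ℕ} {a : Fin n → Ω} {P B : Set Ω}
    (h : ∀ B₀ ⊆ B, B₀.Finite → IsReflected L a P B₀) : IsReflected L a P B :=
  fun m φ c hc => h (Set.range c) (by rintro _ ⟨i, rfl⟩; exact hc i) (Set.finite_range c) m φ c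
    fun i => ⟨i, rfl⟩

theorem realize_comp_equiv {α : Type*} (σ : Ω ≃[L] Ω) (φ : L.Formula α) (v : α → Ω) :
    φ.Realize (fun i => σ (v i)) ↔ φ.Realize v :=
  StrongHomClass.realize_formula σ φ

theorem realize_sumElim_equiv {α β : Type*} (σ : Ω ≃[L] Ω) (φ : L.Formula (α ⊕ β)) (v : α → Ω)
    (w : β → Ω) : φ.Realize (Sum.elim (fun i => σ (v i)) fun j => σ (w j)) ↔
      φ.Realize (Sum.elim v w) := by
  rw [← realize_comp_equiv σ φ (Sum.elim v w)]
  refine iff_of_eq (congrArg _ (funext fun z => ?_))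
  rcases z with z | z <;> rfl

theorem IsReflected.image {n : ℕ} {a : Fin n → Ω} {P B : Set Ω} (h : IsReflected L a P B)
    (σ : Ω ≃[L] Ω) : IsReflected L (fun i => σ (a i)) (σ '' P) (σ '' B) := by
  intro m φ c hc hφ
  choose c' hc' hcc' using hc
  obtain rfl : (fun i => σ (c' i)) = c := funext hcc'
  obtain ⟨d, hd, hφd⟩ := h m φ c' hc' ((realize_sumElim_equiv σ φ a c').1 hφ)
  exact ⟨fun i => σ (d i), fun i => ⟨d i, hd i, rfl⟩, (realize_sumElim_equiv σ φ a d).2 hφd⟩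

/-- A subset of `P`, moved by an automorphism that fixes `a`, is reflected in `P`. -/
theorem isReflected_of_image_subset {n : ℕ} {a : Fin n → Ω} {P B : Set Ω} {σ : Ω ≃[L] Ω}
    (hσ : ∀ i, σ (a i) = a i) (hB : σ '' B ⊆ P) : IsReflected L a P B := by
  intro m φ c hc hφ
  refine ⟨fun i => σ (c i), fun i => hB ⟨c i, hc i, rfl⟩, ?_⟩
  rw [← realize_sumElim_equiv σ] at hφ
  simpa only [hσ] using hφ

variable {μ κ : Cardinal.{u}} {Ind : Set Ω → Set Ω → Set Ω → Prop}

/-- If `a` is independent over `B` from all finite enlargements of `B` that are reflected in `P`,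
then every copy of `B` over `a` inside `P` is a base for the independence of `a` from `P`: a finite
subset of `P` pulls back to a reflected enlargement of `B`. -/
theorem ind_of_forall_isReflected [Nonempty Ω] (hInd : IsIndependenceRelation L μ Ind)
    (hμ : ℵ₀ ≤ μ) {n : ℕ} {a : Fin n → Ω} {P B : Set Ω} (hP : #P < μ) (hB : #B < μ)
    (h : ∀ c : Set Ω, c.Finite → IsReflected L a P (B ∪ c) → Ind (Set.range a) B (B ∪ c))
    {σ : Ω ≃[L] Ω} (hσ : ∀ i, σ (a i) = a i) (hσB : σ '' B ⊆ P) :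
    Ind (Set.range a) (σ '' B) P := by
  have ha : #(Set.range a) < μ := mk_lt_of_finite hμ (Set.finite_range a)
  have hσB' : #(σ '' B) < μ := mk_image_le.trans_lt hB
  refine hInd.symmetry _ _ _ hP hσB' ha ((hInd.finiteCharacter _ _ _ hP hσB' ha).2 ?_)
  intro P₀ hP₀ hfin
  have hc : (σ.symm '' P₀).Finite := hfin.image _
  have hcμ := mk_lt_of_finite hμ hc
  have himg : σ '' (σ.symm '' P₀) = P₀ := by simp [Set.image_image]
  have h1 := h (σ.symm '' P₀) hc (isReflected_of_image_subset hσ (by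
    rw [Set.image_union, himg]
    exact Set.union_subset hσB hP₀))
  have h2 := hInd.mono_right ha hB (mk_union_lt hμ hB hcμ) Set.subset_union_right h1
  have h3 := (hInd.image_iff ha hB hcμ σ).2 h2
  rw [himg, ← Set.range_comp, show σ ∘ a = a from funext hσ] at h3
  exact hInd.symmetry _ _ _ ha hσB' (mk_lt_of_finite hμ hfin) h3

/-- A very small set that is reflected in `P` has a copy over `a` inside `P`, if the pair `(M, P)`
is sufficiently saturated. -/
theorem IsReflected.exists_image_subset {M : L.ElementarySubstructure Ω} {P : Set M}
    (hhom : IsStronglyHomogeneous L Ω μ) (hμ : ℵ₀ ≤ μ) {θ : Cardinal.{u}} (hθ : ℵ₀ ≤ θ)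
    (hM : RealizesTypes (L2 L) (PairOf P) θ) {n : ℕ} {a : Fin n → PairOf P} {B : Set Ω}
    (hBθ : #B ≤ θ) (hB : #B < μ) (h : IsReflected L (pairVal ∘ a) (Subtype.val '' P) B) :
    ∃ σ : Ω ≃[L] Ω, (∀ i, σ (pairVal (a i)) = pairVal (a i)) ∧ σ '' B ⊆ Subtype.val '' P := by
  let x : ULift.{u} (Fin n) → PairOf P := a ∘ ULift.down
  let pred : B → (L2 L).Formula (ULift.{u} (Fin n) ⊕ B) := fun b =>
    (predSymbol L).formula₁ (Term.var (Sum.inr b))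
  let p : Set ((L2 L).Formula (ULift.{u} (Fin n) ⊕ B)) := Set.range pred ∪
    (LHom.sumInl : L →ᴸ L2 L).onFormula '' {φ | φ.Realize (Sum.elim (pairVal ∘ x) (↑))}
  have hpred : ∀ (b : B) (y : B → PairOf P),
      (pred b).Realize (Sum.elim x y) ↔ pairVal (y b) ∈ Subtype.val '' P := fun b y => by
    rw [Formula.realize_rel₁, relMap_predSymbol_iff]
    rfl
  have hlift : ∀ (φ : L.Formula (ULift.{u} (Fin n) ⊕ B)) (y : B → PairOf P),
      ((LHom.sumInl : L →ᴸ L2 L).onFormula φ).Realize (Sum.elim x y) ↔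
        φ.Realize (Sum.elim (pairVal ∘ x) (pairVal ∘ y)) := fun φ y => by
    rw [realize_onFormula_iff, Sum.comp_elim]
  obtain ⟨y, hy⟩ := hM (ULift.{u} (Fin n)) B ((lt_aleph0_of_finite _).le.trans hθ) hBθ x p (by
    intro s hs hsp
    rcases isEmpty_or_nonempty B with hBe | ⟨⟨b₀⟩⟩
    · refine ⟨isEmptyElim, fun φ hφ => ?_⟩
      rcases hsp hφ with ⟨b, rfl⟩ | ⟨φ, hφ', rfl⟩
      · exact isEmptyElim b
      · rw [hlift, Subsingleton.elim (pairVal ∘ _ : B → Ω) (↑)]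
        exact hφ'
    -- Variables that do not occur are sent to some element `e₀` of `P`.
    obtain ⟨d₀, hd₀, -⟩ := h 1 ⊤ (fun _ => b₀) (fun _ => b₀.2) (Formula.realize_top.2 trivial)
    obtain ⟨e₀, he₀, -⟩ := hd₀ 0
    obtain ⟨t, ht, htf, hts⟩ := Set.exists_subset_image_finite_and
      (f := (LHom.sumInl : L →ᴸ L2 L).onFormula)
      (p := fun t => t = s ∩ (LHom.sumInl : L →ᴸ L2 L).onFormula '' {φ : L.Formula _ |
        φ.Realize (Sum.elim (pairVal ∘ x) ((↑) : B → Ω))}) |>.1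
      ⟨_, Set.inter_subset_right, hs.inter_of_left _, rfl⟩
    have := htf.to_subtype
    obtain ⟨m, r, ψ, hr, hψ⟩ := exists_formula_finite_variables
      (Formula.iInf fun φ : t => (φ : L.Formula (ULift.{u} (Fin n) ⊕ B)))
    have hψx : ∀ z : Fin m → Ω,
        (ψ.relabel (Sum.map ULift.down id) : L.Formula (Fin n ⊕ Fin m)).Realize
          (Sum.elim (pairVal ∘ a) z) ↔ ψ.Realize (Sum.elim (pairVal ∘ x) z) := by
      intro z
      rw [Formula.realize_relabel]
      refine iff_of_eq (congrArg _ (funext fun i => ?_))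
      rcases i with i | i <;> rfl
    obtain ⟨d, hd, hψd⟩ := h m (ψ.relabel (Sum.map ULift.down id)) (fun i => r i)
      (fun i => (r i).2) (by
        rw [hψx]
        exact (hψ Ω _ (↑)).1 (Formula.realize_iInf.2 fun φ => ht φ.2))
    choose d' hd' hdd' using hd
    let y : B → PairOf P := Function.extend r (show Fin m → PairOf P from d') fun _ => e₀
    have hyr : pairVal ∘ y ∘ r = d := by
      have hy : y ∘ r = d' := Function.extend_comp hr _ _
      rw [hy]
      exact funext hdd'
    have hyP : ∀ b, pairVal (y b) ∈ Subtype.val '' P := by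
      intro b
      by_cases hb : ∃ i, r i = b
      · obtain ⟨i, rfl⟩ := hb
        exact ⟨d' i, hd' i, (hdd' i).trans (congrFun hyr i).symm⟩
      · exact ⟨e₀, he₀, congrArg pairVal
          (Function.extend_apply' (show Fin m → PairOf P from d') (fun _ => e₀) b hb).symm⟩
    refine ⟨y, fun φ hφ => ?_⟩
    rcases hsp hφ with ⟨b, rfl⟩ | hφ'
    · exact (hpred b y).2 (hyP b)
    · obtain ⟨φ, hφt, rfl⟩ : φ ∈ (LHom.sumInl : L →ᴸ L2 L).onFormula '' t := hts ▸ ⟨hφ, hφ'⟩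
      rw [hlift]
      rw [hψx, ← hyr] at hψd
      exact Formula.realize_iInf.1 ((hψ Ω _ (pairVal ∘ y)).2 hψd) ⟨φ, hφt⟩)
  have hG := isElementaryGraph_range (L := L) (x := Sum.elim (pairVal ∘ x) ((↑) : B → Ω))
    (y := Sum.elim (pairVal ∘ x) (pairVal ∘ y)) fun φ => by
      have key : ∀ φ : L.Formula (ULift.{u} (Fin n) ⊕ B),
          φ.Realize (Sum.elim (pairVal ∘ x) ((↑) : B → Ω)) →
          φ.Realize (Sum.elim (pairVal ∘ x) (pairVal ∘ y)) :=
        fun φ hφ => (hlift φ y).1 (hy _ (Or.inr ⟨φ, hφ, rfl⟩))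
      exact ⟨key φ, fun hφ => by_contra fun hn => key φ.not hn hφ⟩
  obtain ⟨σ, hσ⟩ := hhom.exists_equiv hG (mk_range_le.trans_lt (by
    rw [mk_sum, lift_id, lift_id]
    exact add_lt_of_lt hμ ((lt_aleph0_of_finite _).trans_le hμ) hB))
  refine ⟨σ, fun i => hσ _ ⟨Sum.inl ⟨i⟩, rfl⟩, ?_⟩
  rintro _ ⟨b, hb, rfl⟩
  have hb' : σ b = pairVal (y ⟨b, hb⟩) := hσ _ ⟨Sum.inr ⟨b, hb⟩, rfl⟩
  rw [hb', ← hpred]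
  exact hy _ (Or.inl ⟨⟨b, hb⟩, rfl⟩)

/-- Tuples that satisfy the same special formulas in sufficiently saturated lovely pairs correspond
under a free map. -/
theorem exists_isFreeMap [Nonempty Ω] {M N : L.ElementarySubstructure Ω} {P : Set M} {Q : Set N}
    (hInd : IsIndependenceRelation L μ Ind) (hhom : IsStronglyHomogeneous L Ω μ) (hκ : ℵ₀ ≤ κ)
    (hκ₀ : kappaZero μ Ind < κ) (hκμ : κ < μ)
    (hM : IsLovelySet L μ κ Ind (M : Set Ω) (Subtype.val '' P))
    (hN : IsLovelySet L μ κ Ind (N : Set Ω) (Subtype.val '' Q))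
    (hMs : RealizesTypes (L2 L) (PairOf P) κ) (hNs : RealizesTypes (L2 L) (PairOf Q) κ) {n : ℕ}
    (a : Fin n → PairOf P) (b : Fin n → PairOf Q)
    (hab : ∀ χ : (L2 L).Formula (Fin n), IsSpecial χ → (χ.Realize a ↔ χ.Realize b)) :
    ∃ (A : Set Ω) (σ : Ω ≃[L] Ω),
      IsFreeMap κ Ind (M : Set Ω) (Subtype.val '' P) (N : Set Ω) (Subtype.val '' Q) A σ ∧
      ∀ i, pairVal (a i) ∈ A ∧ σ (pairVal (a i)) = pairVal (b i) := by
  have hμ := hκ.trans hκμ.le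
  have hsp : ∀ (m : ℕ) (φ : L.Formula (Fin n ⊕ Fin m)),
      (∃ d : Fin m → Ω, (∀ i, d i ∈ Subtype.val '' P) ∧ φ.Realize (Sum.elim (pairVal ∘ a) d)) ↔
      ∃ d : Fin m → Ω, (∀ i, d i ∈ Subtype.val '' Q) ∧ φ.Realize (Sum.elim (pairVal ∘ b) d) := by
    intro m φ
    rw [← realize_specialFormula_iff, ← realize_specialFormula_iff]
    exact hab _ ⟨m + 0, _, rfl⟩
  set a' : Fin n → Ω := pairVal ∘ a with ha'
  set b' : Fin n → Ω := pairVal ∘ b with hb'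
  set P' : Set Ω := Subtype.val '' P with hP'
  set Q' : Set Ω := Subtype.val '' Q with hQ'
  -- The case without quantified variables: the tuples have the same `L`-type.
  obtain ⟨ρ, hρ⟩ := hhom.exists_equiv (isElementaryGraph_range (L := L) (x := a') (y := b')
    fun φ => by
      have h0 := hsp 0 (φ.relabel Sum.inl)
      simpa [Formula.realize_relabel] using h0)
    (mk_lt_of_finite hμ (Set.finite_range _))
  have hρ' : ∀ i, ρ (a' i) = b' i := fun i => hρ _ ⟨i, rfl⟩
  have hρs : ∀ i, ρ.symm (b' i) = a' i := fun i => by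
    rw [← hρ', Language.Equiv.symm_apply_apply]
  -- One quantified variable, with an equation: the tuples have the same entries in the predicate.
  have hpred : ∀ i, a' i ∈ P' ↔ b' i ∈ Q' := by
    intro i
    have h1 := hsp 1 ((Term.var (Sum.inl i) : L.Term (Fin n ⊕ Fin 1)).equal
      (Term.var (Sum.inr 0)))
    simp only [Formula.realize_equal, Term.realize_var, Sum.elim_inl, Sum.elim_inr] at h1
    constructor
    · intro h
      obtain ⟨d, hd, hid⟩ := h1.1 ⟨fun _ => a' i, fun _ => h, rfl⟩
      rw [hid]
      exact hd 0
    · intro h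
      obtain ⟨d, hd, hid⟩ := h1.2 ⟨fun _ => b' i, fun _ => h, rfl⟩
      rw [hid]
      exact hd 0
  -- The copy `Q₁` of `Q` over `a` reflects the same sets as `P`, so one set `B` serves both.
  set Q₁ : Set Ω := ρ.symm '' Q' with hQ₁
  have hρQ₁ : ρ '' Q₁ = Q' := by simp [hQ₁, Set.image_image]
  have hQ₁μ : #Q₁ < μ := mk_image_le.trans_lt hN.small_pred
  have hrefl : ∀ B, IsReflected L a' P' B ↔ IsReflected L a' Q₁ B := by
    intro B
    have h1 : ∀ (m : ℕ) (φ : L.Formula (Fin n ⊕ Fin m)),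
        (∃ d : Fin m → Ω, (∀ i, d i ∈ P') ∧ φ.Realize (Sum.elim a' d)) ↔
          ∃ d : Fin m → Ω, (∀ i, d i ∈ Q₁) ∧ φ.Realize (Sum.elim a' d) := by
      intro m φ
      rw [hsp]
      constructor
      · rintro ⟨d, hd, hφ⟩
        refine ⟨fun i => ρ.symm (d i), fun i => ⟨d i, hd i, rfl⟩, ?_⟩
        rw [← realize_sumElim_equiv ρ.symm] at hφ
        simpa only [hρs] using hφ
      · rintro ⟨d, hd, hφ⟩
        refine ⟨fun i => ρ (d i), fun i => hρQ₁ ▸ ⟨d i, hd i, rfl⟩, ?_⟩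
        rw [← realize_sumElim_equiv ρ] at hφ
        simpa only [hρ'] using hφ
    exact forall₄_congr fun m φ c _ => imp_congr_right fun _ => h1 m φ
  obtain ⟨B, hB, hBκ₀, hBmax⟩ := hInd.exists_no_dependent_extension hμ (hκ₀.trans hκμ)
    (Set.finite_range a') (IsReflected L a' P') (fun _ => isReflected_of_finite)
    (fun _ _ hsub h => h.mono hsub)
    (isReflected_of_image_subset (σ := Language.Equiv.refl L Ω) (fun _ => rfl) (by simp))
  have hBκ := hBκ₀.trans_lt hκ₀
  have hBμ := hBκ.trans hκμ
  have hBQ : IsReflected L b' Q' (ρ '' B) := by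
    have := ((hrefl B).1 hB).image ρ
    rwa [hρQ₁, show (fun i => ρ (a' i)) = b' from funext hρ'] at this
  obtain ⟨σ, hσ, hσB⟩ := hB.exists_image_subset hhom hμ hκ hMs hBκ.le hBμ
  obtain ⟨τ, hτ, hτB⟩ := hBQ.exists_image_subset hhom hμ hκ hNs (mk_image_le.trans hBκ.le)
    (mk_image_le.trans_lt hBμ)
  have hτ' : ∀ i, τ (b' i) = b' i := hτ
  have ha'μ : #(Set.range a') < μ := mk_lt_of_finite hμ (Set.finite_range a')
  have hindP : Ind (Set.range a') (σ '' B) P' :=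
    ind_of_forall_isReflected hInd hμ hM.small_pred hBμ hBmax hσ hσB
  let υ : Ω ≃[L] Ω := ρ.symm.comp (τ.comp ρ)
  have hυB : ρ '' (υ '' B) = τ '' (ρ '' B) := by
    simp [υ, Set.image_image]
  have hυBQ : υ '' B ⊆ Q₁ := by
    rw [hQ₁, ← Set.image_subset_image_iff ρ.injective, hρQ₁, hυB]
    exact hτB
  have hindQ₁ : Ind (Set.range a') (υ '' B) Q₁ :=
    ind_of_forall_isReflected hInd hμ hQ₁μ hBμ
      (fun c hc hr => hBmax c hc ((hrefl _).2 hr))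
      (fun i => by
        change ρ.symm (τ (ρ (a' i))) = a' i
        rw [hρ', hτ', hρs]) hυBQ
  have hindQ : Ind (Set.range b') (τ '' (ρ '' B)) Q' := by
    have := (hInd.image_iff ha'μ (mk_image_le.trans_lt hBμ) hQ₁μ ρ).2 hindQ₁
    rwa [hρQ₁, hυB, ← Set.range_comp, show ρ ∘ a' = b' from funext hρ'] at this
  let η : Ω ≃[L] Ω := τ.comp (ρ.comp σ.symm)
  have hηa : ∀ i, η (a' i) = b' i := fun i => by
    change τ (ρ (σ.symm (a' i))) = b' i
    rw [show σ.symm (a' i) = a' i by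
      conv_lhs => rw [← show σ (a' i) = a' i from hσ i]
      exact Language.Equiv.symm_apply_apply σ _, hρ', hτ']
  have hηB : η '' (σ '' B) = τ '' (ρ '' B) := by
    simp [η, Set.image_image]
  have himg : η '' (Set.range a' ∪ σ '' B) = Set.range b' ∪ τ '' (ρ '' B) := by
    rw [Set.image_union, hηB, ← Set.range_comp, show η ∘ a' = b' from funext hηa]
  refine ⟨Set.range a' ∪ σ '' B, η, ⟨?_, ?_, ?_, ?_, ?_, ?_⟩, fun i => ⟨Or.inl ⟨i, rfl⟩, hηa i⟩⟩
  · refine Set.union_subset ?_ (hσB.trans hM.subset)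
    rintro _ ⟨i, rfl⟩
    exact pairVal_mem _
  · rw [himg]
    refine Set.union_subset ?_ (hτB.trans hN.subset)
    rintro _ ⟨i, rfl⟩
    exact pairVal_mem _
  · exact mk_union_lt hκ (mk_lt_of_finite hκ (Set.finite_range a')) (mk_image_le.trans_lt hBκ)
  · rintro _ (⟨i, rfl⟩ | hx)
    · rw [hηa]
      exact hpred i
    · exact iff_of_true (hσB hx) (hτB (hηB ▸ ⟨_, hx, rfl⟩))
  · exact hInd.free_union hμ ha'μ hM.small_pred hσB
      (fun x hx => ⟨Or.inr hx, hσB hx⟩) hindP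
  · rw [himg]
    exact hInd.free_union hμ (mk_lt_of_finite hμ (Set.finite_range b')) hN.small_pred hτB
      (fun x hx => ⟨Or.inr hx, hτB hx⟩) hindQ

end Reflection

/-! ### Boolean combinations and complete types -/

section BooleanCombinations

variable {L : FirstOrder.Language.{u, u}} {T : L.Theory} {α : Type w}

theorem not_mem_completeType (p : T.CompleteType α) (φ : L.Formula α) :
    Formula.equivSentence φ.not ∈ p ↔ Formula.equivSentence φ ∉ p := by
  obtain ⟨M, v, rfl⟩ := Theory.exists_modelType_is_realized_in T p
  rw [Theory.CompleteType.formula_mem_typeOf, Theory.CompleteType.formula_mem_typeOf,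
    Formula.realize_not]

theorem inf_mem_completeType (p : T.CompleteType α) (φ ψ : L.Formula α) :
    Formula.equivSentence (φ ⊓ ψ) ∈ p ↔
      Formula.equivSentence φ ∈ p ∧ Formula.equivSentence ψ ∈ p := by
  obtain ⟨M, v, rfl⟩ := Theory.exists_modelType_is_realized_in T p
  rw [Theory.CompleteType.formula_mem_typeOf, Theory.CompleteType.formula_mem_typeOf,
    Theory.CompleteType.formula_mem_typeOf, Formula.realize_inf]

theorem sup_mem_completeType (p : T.CompleteType α) (φ ψ : L.Formula α) :
    Formula.equivSentence (φ ⊔ ψ) ∈ p ↔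
      Formula.equivSentence φ ∈ p ∨ Formula.equivSentence ψ ∈ p := by
  obtain ⟨M, v, rfl⟩ := Theory.exists_modelType_is_realized_in T p
  rw [Theory.CompleteType.formula_mem_typeOf, Theory.CompleteType.formula_mem_typeOf,
    Theory.CompleteType.formula_mem_typeOf, Formula.realize_sup]

/-- If the truth of `φ` in a complete type depends only on the formulas from the class `S` in that
type, then `φ` is equivalent to a Boolean combination of formulas from `S`: compactness of the space
of types, applied to the clopen set defined by `φ` and to its complement. -/
theorem exists_isBooleanCombination_iff (S : L.Formula α → Prop) (hS : ∃ χ, S χ) (φ : L.Formula α)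
    (h : ∀ p q : T.CompleteType α,
      (∀ χ, S χ → (Formula.equivSentence χ ∈ p ↔ Formula.equivSentence χ ∈ q)) →
      Formula.equivSentence φ ∈ p → Formula.equivSentence φ ∈ q) :
    ∃ ψ : L.Formula α, IsBooleanCombination S ψ ∧ φ ⇔[T] ψ := by
  obtain ⟨χ₀, hχ₀⟩ := hS
  let D : L.Formula α → Set (T.CompleteType α) := fun χ => T.typesWith (Formula.equivSentence χ)
  have hD : ∀ χ p, p ∈ D χ ↔ Formula.equivSentence χ ∈ p := fun χ p => Iff.rfl
  have hopen : ∀ χ, IsOpen (D χ) := fun χ => CompleteType.isOpen_typesWith _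
  have hclosed : ∀ χ, IsClosed (D χ) := fun χ => CompleteType.isClosed_typesWith _
  have htop : ∀ p, p ∈ D (χ₀ ⊔ χ₀.not) := fun p => by
    rw [hD, sup_mem_completeType, not_mem_completeType]
    exact em _
  have hbot : ∀ p, p ∉ D (χ₀ ⊓ χ₀.not) := fun p => by
    rw [hD, inf_mem_completeType, not_mem_completeType]
    exact fun hp => hp.2 hp.1
  have hsep : ∀ p ∈ D φ, ∀ q ∉ D φ, ∃ χ, IsBooleanCombination S χ ∧ p ∈ D χ ∧ q ∉ D χ := by
    intro p hp q hq
    by_contra! hcon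
    refine hq (h p q (fun χ hχ => ⟨fun hpχ => hcon χ (.of hχ) hpχ, fun hqχ => ?_⟩) hp)
    by_contra hpχ
    have := hcon χ.not (.not (.of hχ)) ((not_mem_completeType p χ).2 hpχ)
    exact (not_mem_completeType q χ).1 this hqχ
  have h₁ : ∀ p ∈ D φ, ∃ χ, IsBooleanCombination S χ ∧ p ∈ D χ ∧ Disjoint (D φ)ᶜ (D χ) := by
    intro p hp
    refine (hopen φ).isClosed_compl.isCompact.induction_on
      (p := fun s => ∃ χ, IsBooleanCombination S χ ∧ p ∈ D χ ∧ Disjoint s (D χ))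
      ⟨_, .sup (.of hχ₀) (.not (.of hχ₀)), htop p, Set.empty_disjoint _⟩ ?_ ?_ ?_
    · rintro s t hst ⟨χ, hχ, hpχ, hd⟩
      exact ⟨χ, hχ, hpχ, hd.mono_left hst⟩
    · rintro s t ⟨χ, hχ, hpχ, hd⟩ ⟨χ', hχ', hpχ', hd'⟩
      refine ⟨χ ⊓ χ', .inf hχ hχ', (inf_mem_completeType p χ χ').2 ⟨hpχ, hpχ'⟩, ?_⟩
      rw [Set.disjoint_left] at *
      rintro q (hq | hq) hqχ
      · exact hd hq ((inf_mem_completeType q χ χ').1 hqχ).1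
      · exact hd' hq ((inf_mem_completeType q χ χ').1 hqχ).2
    · intro q hq
      obtain ⟨χ, hχ, hpχ, hqχ⟩ := hsep p hp q hq
      exact ⟨(D χ)ᶜ, mem_nhdsWithin_of_mem_nhds ((hclosed χ).isOpen_compl.mem_nhds hqχ), χ, hχ, hpχ,
        disjoint_compl_left⟩
  obtain ⟨ψ, hψ, hφψ, hψφ⟩ : ∃ ψ, IsBooleanCombination S ψ ∧ D φ ⊆ D ψ ∧ D ψ ⊆ D φ := by
    refine (hclosed φ).isCompact.induction_on
      (p := fun s => ∃ χ, IsBooleanCombination S χ ∧ s ⊆ D χ ∧ D χ ⊆ D φ)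
      ⟨_, .inf (.of hχ₀) (.not (.of hχ₀)), Set.empty_subset _, fun q hq => absurd hq (hbot q)⟩
      ?_ ?_ ?_
    · rintro s t hst ⟨χ, hχ, hs, hd⟩
      exact ⟨χ, hχ, hst.trans hs, hd⟩
    · rintro s t ⟨χ, hχ, hs, hd⟩ ⟨χ', hχ', hs', hd'⟩
      refine ⟨χ ⊔ χ', .sup hχ hχ', ?_, fun q hq => ?_⟩
      · rintro q (hq | hq)
        · exact (sup_mem_completeType q χ χ').2 (Or.inl (hs hq))
        · exact (sup_mem_completeType q χ χ').2 (Or.inr (hs' hq))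
      · rcases (sup_mem_completeType q χ χ').1 hq with hq | hq
        · exact hd hq
        · exact hd' hq
    · intro p hp
      obtain ⟨χ, hχ, hpχ, hd⟩ := h₁ p hp
      exact ⟨D χ, mem_nhdsWithin_of_mem_nhds ((hopen χ).mem_nhds hpχ), χ, hχ, subset_rfl,
        Set.disjoint_compl_left_iff_subset.1 hd⟩
  refine ⟨ψ, hψ, fun M v xs => ?_⟩
  rw [BoundedFormula.realize_iff, Formula.boundedFormula_realize_eq_realize,
    Formula.boundedFormula_realize_eq_realize, ← Theory.CompleteType.formula_mem_typeOf (T := T),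
    ← Theory.CompleteType.formula_mem_typeOf (T := T)]
  exact ⟨fun hp => hφψ hp, fun hp => hψφ hp⟩

end BooleanCombinations

/-! ### Realizing types of the theory of lovely pairs -/

section Realization

variable {L : FirstOrder.Language.{u, u}}

theorem RealizesTypes.mono {N : Type u} [L.Structure N] {θ θ' : Cardinal.{u}}
    (h : RealizesTypes L N θ) (hθ : θ' ≤ θ) : RealizesTypes L N θ' :=
  fun α β hα hβ => h α β (hα.trans hθ) (hβ.trans hθ)

theorem RealizesTypes.of_equiv {N N' : Type u} [L.Structure N] [L.Structure N']
    {θ : Cardinal.{u}} (h : RealizesTypes L N θ) (e : N ≃[L] N') : RealizesTypes L N' θ := by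
  intro α β hα hβ x p hp
  have key : ∀ (f : N' ≃[L] N) (φ : L.Formula (α ⊕ β)) (y : β → N'),
      φ.Realize (Sum.elim (f ∘ x) (f ∘ y)) ↔ φ.Realize (Sum.elim x y) := by
    intro f φ y
    rw [← Sum.comp_elim]
    exact StrongHomClass.realize_formula f φ
  obtain ⟨y, hy⟩ := h α β hα hβ (e.symm ∘ x) p fun s hs hsp => by
    obtain ⟨y, hy⟩ := hp s hs hsp
    exact ⟨e.symm ∘ y, fun φ hφ => (key e.symm φ y).2 (hy φ hφ)⟩
  refine ⟨e ∘ y, fun φ hφ => (key e.symm φ _).1 ?_⟩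
  have : e.symm ∘ e ∘ y = y := funext fun b => Language.Equiv.symm_apply_apply e (y b)
  rw [this]
  exact hy φ hφ

/-- A structure that realizes types realizes the types of finite tuples from elementarily equivalent
structures. -/
theorem RealizesTypes.exists_tuple {M N : Type u} [L.Structure M] [L.Structure N]
    {θ : Cardinal.{u}} (h : RealizesTypes L N θ) (hθ : ℵ₀ ≤ θ) (hMN : M ≅[L] N) {n : ℕ}
    (v : Fin n → M) :
    ∃ a : Fin n → N, ∀ φ : L.Formula (Fin n), φ.Realize v ↔ φ.Realize a := by
  let r : L.Formula (Fin n) → L.Formula (PEmpty.{u + 1} ⊕ ULift.{u} (Fin n)) :=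
    Formula.relabel fun i => Sum.inr ⟨i⟩
  have hr : ∀ φ (y : ULift.{u} (Fin n) → N),
      (r φ).Realize (Sum.elim PEmpty.elim y) ↔ φ.Realize (y ∘ ULift.up) := by
    intro φ y
    rw [Formula.realize_relabel]
    rfl
  obtain ⟨y, hy⟩ := h PEmpty.{u + 1} (ULift.{u} (Fin n)) (by simp)
    ((lt_aleph0_of_finite _).le.trans hθ) PEmpty.elim (r '' {φ | φ.Realize v}) (by
      intro s hs hsp
      obtain ⟨t, ht, htf, rfl⟩ := Set.exists_subset_image_finite_and
        (p := fun t => t = s) |>.1 ⟨s, hsp, hs, rfl⟩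
      have := htf.to_subtype
      let χ : L.Sentence := Formula.iExs (Fin n)
        (Formula.relabel (Sum.inr : Fin n → Empty ⊕ Fin n) (Formula.iInf fun φ : t => φ.1))
      have hχ : M ⊨ χ := by
        refine Formula.realize_iExs.2 ⟨v, ?_⟩
        rw [Formula.realize_relabel, Sum.elim_comp_inr, Formula.realize_iInf]
        exact fun φ => ht φ.2
      obtain ⟨y, hy⟩ := Formula.realize_iExs.1 ((hMN.realize_sentence χ).1 hχ)
      rw [Formula.realize_relabel, Sum.elim_comp_inr, Formula.realize_iInf] at hy
      refine ⟨y ∘ ULift.down, ?_⟩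
      rintro _ ⟨φ, hφ, rfl⟩
      exact (hr φ _).2 (hy ⟨φ, hφ⟩))
  have key : ∀ φ : L.Formula (Fin n), φ.Realize v → φ.Realize (y ∘ ULift.up) :=
    fun φ hφ => (hr φ y).1 (hy _ ⟨φ, hφ, rfl⟩)
  exact ⟨y ∘ ULift.up, fun φ => ⟨key φ, fun hφ => by_contra fun hn => key φ.not hn hφ⟩⟩

theorem card_L2_le {θ : Cardinal.{u}} (hθ : ℵ₀ ≤ θ) (hL : L.card ≤ θ) : (L2 L).card ≤ θ := by
  have : ∀ l, Countable (predLanguage.Relations l) := fun l =>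
    (show Subsingleton (PredRel l) from ⟨fun a b => by cases a; cases b; rfl⟩).to_countable
  have : ∀ l, Countable (predLanguage.Functions l) := fun l =>
    (inferInstance : Countable Empty)
  have hpred : predLanguage.card ≤ ℵ₀ := by
    rw [Language.card, mk_le_aleph0_iff]
    unfold Language.Symbols
    infer_instance
  rw [card_sum, lift_uzero]
  exact add_le_of_le hθ hL ((lift_le.2 hpred).trans (by simpa using hθ))

/-- A structure for the language of pairs whose `L`-reduct embeds elementarily in `Ω` is isomorphic
to a pair given by an elementary substructure of `Ω`. -/
theorem exists_pairOf_equiv {Ω N : Type u} [L.Structure Ω] [(L2 L).Structure N]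
    (f : letI := (LHom.sumInl : L →ᴸ L2 L).reduct N; N ↪ₑ[L] Ω) :
    ∃ (M : L.ElementarySubstructure Ω) (P : Set M), Nonempty (N ≃[L2 L] PairOf P) := by
  let _ := (LHom.sumInl : L →ᴸ L2 L).reduct N
  let e := f.toEmbedding.equivRange
  have he : ∀ x, f (e.symm x) = x := fun x => by
    have := Language.Embedding.equivRange_apply f.toEmbedding (e.symm x)
    exact this.symm.trans (congrArg Subtype.val (Language.Equiv.apply_symm_apply e x))
  let M : L.ElementarySubstructure Ω := ⟨f.toEmbedding.toHom.range, fun n φ x => by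
    rw [show (↑) ∘ x = f ∘ e.symm ∘ x from funext fun i => (he (x i)).symm, f.map_formula]
    exact StrongHomClass.realize_formula e.symm φ⟩
  let P : Set M := {x | Structure.RelMap (predSymbol L) fun _ : Fin 1 => e.symm x}
  refine ⟨M, P, ⟨⟨e.toEquiv, fun {l} F x => ?_, fun {l} R x => ?_⟩⟩⟩
  · rcases F with F | F
    · exact e.map_fun F x
    · exact Empty.elim F
  · rcases R with R | R
    · exact e.map_rel R x
    · cases R
      have h : (fun _ : Fin 1 => e.symm (e (x 0))) = x := funext fun i => by
        rw [Language.Equiv.symm_apply_apply, Subsingleton.elim i 0]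
      change Structure.RelMap (predSymbol L) (fun _ : Fin 1 => e.symm (e (x 0))) ↔
        Structure.RelMap (predSymbol L) x
      rw [h]

end Realization

section LovelyTypes

variable {L : FirstOrder.Language.{u, u}} {Ω : Type u} [L.Structure Ω] [Nonempty Ω]
  {μ κ : Cardinal.{u}} {Ind : Set Ω → Set Ω → Set Ω → Prop}

/-- The `L`-reduct of a model of the theory of lovely pairs is elementarily equivalent to the
monster: the reduct of every lovely pair is an elementary substructure of it. -/
theorem reduct_elementarilyEquivalent {N : Type u} [(L2 L).Structure N]
    (hN : N ⊨ lovelyTheory L μ κ Ind) :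
    letI := (LHom.sumInl : L →ᴸ L2 L).reduct N; N ≅[L] Ω := by
  let _ := (LHom.sumInl : L →ᴸ L2 L).reduct N
  have key : ∀ φ : L.Sentence, Ω ⊨ φ → N ⊨ φ := by
    intro φ hφ
    refine (LHom.realize_onSentence N (LHom.sumInl : L →ᴸ L2 L) φ).1 ?_
    refine Theory.realize_sentence_of_mem (lovelyTheory L μ κ Ind) fun M P _ => ?_
    refine (LHom.realize_onSentence (PairOf P) (LHom.sumInl : L →ᴸ L2 L) φ).2 ?_
    exact (M.realize_sentence φ).2 hφ
  refine elementarilyEquivalent_iff.2 fun φ => ⟨fun h => by_contra fun hn => ?_, key φ⟩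
  exact key φ.not hn h

/-- Every type of the theory of lovely pairs is realized in a lovely pair that realizes types: a
small structure realizing the type and realizing types is an elementary substructure of the monster
with a predicate, and it is lovely because loveliness is first order. -/
theorem exists_isLovelyPair_realizing (hsat : IsSaturated L Ω μ) (hμ : μ.IsStrongLimit)
    (hκ : ℵ₀ ≤ κ) (hL : L.card ≤ κ) (hκμ : κ < μ) (hfo : LovelinessIsFirstOrder L μ κ Ind) {n : ℕ}
    (p : (lovelyTheory L μ κ Ind).CompleteType (Fin n)) :
    ∃ (M : L.ElementarySubstructure Ω) (P : Set M) (a : Fin n → PairOf P),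
      IsLovelyPair L μ κ Ind M P ∧ RealizesTypes (L2 L) (PairOf P) κ ∧
        ∀ φ : (L2 L).Formula (Fin n), Formula.equivSentence φ ∈ p ↔ φ.Realize a := by
  obtain ⟨l, hl, hfo⟩ := hfo
  obtain ⟨N₀, v, rfl⟩ := Theory.exists_modelType_is_realized_in _ p
  have hθ : ℵ₀ ≤ max l κ := hκ.trans (le_max_right _ _)
  obtain ⟨N, _, _, hN₀N, hNcard, hN⟩ := exists_realizesTypes (L := L2 L) N₀ hθ
    (card_L2_le hθ (hL.trans (le_max_right _ _)))
  obtain ⟨b, hb⟩ := hN.exists_tuple hθ hN₀N v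
  have hNT : N ⊨ lovelyTheory L μ κ Ind := hN₀N.theory_model
  let _ := (LHom.sumInl : L →ᴸ L2 L).reduct N
  have hNμ : #N < μ := hNcard.trans_lt (hμ.isStrongPrelimit (max_lt hl hκμ))
  obtain ⟨f⟩ := hsat.exists_elementaryEmbedding hNμ (reduct_elementarilyEquivalent hNT)
  obtain ⟨M, P, ⟨e⟩⟩ := exists_pairOf_equiv f
  have hMμ : #M < μ := (mk_congr e.toEquiv).symm.trans_lt hNμ
  have hP : RealizesTypes (L2 L) (PairOf P) (max l κ) := hN.of_equiv e
  refine ⟨M, P, e ∘ b, hfo M P hMμ (StrongHomClass.theory_model e)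
    (hP.isSaturated hθ (le_max_left _ _)), hP.mono (le_max_right _ _), fun φ => ?_⟩
  rw [Theory.CompleteType.formula_mem_typeOf, hb φ]
  exact (StrongHomClass.realize_formula e φ).symm

end LovelyTypes

end LovelyPairs

theorem mainTheorem3 {L : FirstOrder.Language.{u, u}} (T : L.Theory) (Ω : Type u) [L.Structure Ω]
    [Nonempty Ω] (μ : Cardinal.{u}) (hΩ : IsMonster T Ω μ)
    (Ind : Set Ω → Set Ω → Set Ω → Prop) (hInd : IsIndependenceRelation L μ Ind)
    (κ : Cardinal.{u}) (hκ : max (kappaZero μ Ind) (max ℵ₀ L.card) < κ) (hκμ : κ < μ)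
    (hfo : LovelinessIsFirstOrder L μ κ Ind)
    {n : ℕ} (φ : (L2 L).Formula (Fin n)) :
    ∃ ψ : (L2 L).Formula (Fin n),
      IsBooleanCombination IsSpecial ψ ∧ φ ⇔[lovelyTheory L μ κ Ind] ψ := by
  obtain ⟨hκ₀, hκ₁⟩ := max_lt_iff.1 hκ
  obtain ⟨hκℵ, hκL⟩ := max_lt_iff.1 hκ₁
  have hhom := hΩ.homogeneous
  have hμ := hΩ.uncountable.le
  refine exists_isBooleanCombination_iff IsSpecial ⟨specialFormula (m := 0) ⊤, 0, ⊤, rfl⟩ φ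
    fun p q hpq hp => ?_
  obtain ⟨M, P, a, hM, hMs, ha⟩ := exists_isLovelyPair_realizing hΩ.saturated hΩ.strongLimit
    hκℵ.le hκL.le hκμ hfo p
  obtain ⟨N, Q, b, hN, hNs, hb⟩ := exists_isLovelyPair_realizing hΩ.saturated hΩ.strongLimit
    hκℵ.le hκL.le hκμ hfo q
  have hM' := hM.isLovelySet hhom hμ hκμ
  have hN' := hN.isLovelySet hhom hμ hκμ
  obtain ⟨A, σ, hσ, hab⟩ := exists_isFreeMap hInd hhom hκℵ.le hκ₀ hκμ hM' hN' hMs hNs a b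
    fun χ hχ => (ha χ).symm.trans ((hpq χ hχ).trans (hb χ))
  have hiff : φ.Realize a ↔ φ.Realize b := hσ.realize_iff hInd hhom hκℵ.le hκ₀
    hκμ hM' hN' φ (fun i => (hab i).1) (fun i => Fin.elim0 i) (fun i => (hab i).2)
    (fun i => Fin.elim0 i)
  exact (hb φ).2 (hiff.1 ((ha φ).1 hp))
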